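/- For a graph $F$, let $\mathcal K_3(F)$ be the $3$-uniform hypergraph on $V(F)$ whose edges are the vertex sets of the triangles of $F$; it is called linear if any two distinct edges share at most one vertex. For graphs $G$ and $F$ write $G \to_{\mathrm{ind}} (F)^{\Delta}$ if for every $2$-colouring of the triangles of $G$ there is an induced copy of $F$ in $G$ all of whose triangles have the same colour, and let $R_{\mathrm{ind}}^{\Delta}(F)$ be the smallest integer $N$ such that some graph $G$ on $N$ vertices satisfies $G \to_{\mathrm{ind}} (F)^{\Delta}$. Theorem. Let $F$ be a graph on $n$ vertices such that $\mathcal K_3(F)$ is linear. Then there is a graph $G$ on exactly $2^{2^{2^{40n}}}$ vertices with $G \to_{\mathrm{ind}} (F)^{\Delta}$, and in particular $$R_{\mathrm{ind}}^{\Delta}(F)\le 2^{2^{2^{40n}}}.$$ -/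

import Mathlib

/-- The triangle 3-graph `K₃(F)`: the 3-uniform hypergraph on the vertex set of `F`, given by its
set of edges, which are the vertex sets of the triangles of `F`. -/
def triangleHypergraph {V : Type*} (F : SimpleGraph V) : Set (Finset V) :=
  F.cliqueSet 3

/-- A hypergraph, given by its set of edges, is linear if any two distinct edges share at most one
vertex. -/
def IsLinearHypergraph {V : Type*} (E : Set (Finset V)) : Prop :=
  E.Pairwise fun s t => ((s : Set V) ∩ (t : Set V)).Subsingleton

/-- `TriangleArrow G F`: for every 2-colouring of the triangles of `G` there is an induced copy of
`F` in `G` (an embedding of graphs preserves and reflects adjacency) and a colour `c` such that all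
triangles of `G` whose vertices lie in the copy, i.e. all triangles of the copy, have colour `c`. -/
def TriangleArrow {W V : Type*} (G : SimpleGraph W) (F : SimpleGraph V) : Prop :=
  ∀ χ : triangleHypergraph G → Bool, ∃ (φ : F ↪g G) (c : Bool),
    ∀ t : triangleHypergraph G, ((t : Finset W) : Set W) ⊆ Set.range φ → χ t = c

/-- The number `R_ind^Δ(F)`: the smallest `N` such that some graph on `N` vertices arrows `F`. -/
noncomputable def inducedTriangleRamsey {V : Type*} (F : SimpleGraph V) : ℕ :=
  sInf {N : ℕ | ∃ G : SimpleGraph (Fin N), TriangleArrow G F}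

/-!
The host graph is a quasirandom graph `G` on `N = 2 ^ (2 * r)` vertices, defined by a symmetric
Hadamard matrix: by Lindsey's lemma (`sq_sum_hadamard_le`) both `G` and its complement have density
`1 / 2` up to `O (N ^ (-1 / 2))` in cut norm. Given a 2-colouring of the triangles of `G`, the weak
regularity lemma (`exists_weakRegular_partition`) supplies a partition of the vertices into
boundedly many cells such that, up to `ε` in cut norm, each of the two colour classes equals its
average over the boxes of the partition. Since large boxes contain about one eighth of all triples
as triangles, these two averages, now defined on *all* triples of vertices in large cells, cannot
both be small (`exists_cellMean_colourIndicator_ge`), so the dense model 2-colours a complete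
3-graph.

Ramsey's theorem for triples, with the Erdős–Rado bound `M = 2 ^ 16 ^ n`, applied to `M` random
vertices, shows that in one of the colours a proportion of order `M ^ (-n)` of all `n`-tuples is
homogeneous for the dense model (`exists_many_homogeneous`). The counting lemma
(`abs_sum_prod_sub_sum_prod_le`) carries this over to the number of monochromatic induced copies of
`F` in `G`. A copy is controlled by one factor for each triangle of `F` and one factor for each pair
of vertices that lies in no triangle; linearity of the triangle hypergraph says exactly that any two
of these hyperedges share at most one vertex (`controlSystem_inter_subsingleton`), and then
closeness in cut norm over boxes of vertex sets suffices to exchange the factors one at a time.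

The error only has to beat `M ^ (-n)`, not the (much smaller) measure of the cells. So `ε` is an
inverse double exponential in `n`, the number of cells is triply exponential, and so is `N`.
-/

/-! ### Ramsey's theorem for ordered triples -/

/-- The asymmetric form of Ramsey's theorem for pairs `i < j`, with the bound `2 ^ (a + b)`. -/
theorem exists_homogeneous_pairs_aux {α : Type*} [LinearOrder α] (χ : α → α → Bool) :
    ∀ (s a b : ℕ), s = a + b → ∀ S : Finset α, 2 ^ s ≤ S.card →
      (∃ Q ⊆ S, Q.card = a ∧ ∀ i ∈ Q, ∀ j ∈ Q, i < j → χ i j = true) ∨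
      (∃ Q ⊆ S, Q.card = b ∧ ∀ i ∈ Q, ∀ j ∈ Q, i < j → χ i j = false) := by
  classical
  intro s
  induction s with
  | zero =>
    intro a b h S _
    exact Or.inl ⟨∅, by simp, by simp; omega, by simp⟩
  | succ s ih =>
    intro a b h S hS
    rcases Nat.eq_zero_or_pos a with rfl | ha
    · exact Or.inl ⟨∅, by simp, by simp, by simp⟩
    rcases Nat.eq_zero_or_pos b with rfl | hb
    · exact Or.inr ⟨∅, by simp, by simp, by simp⟩
    have hne : S.Nonempty := Finset.card_pos.1 (lt_of_lt_of_le (by positivity) hS)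
    set x := S.min' hne with hx
    have hxS : x ∈ S := S.min'_mem hne
    have hmin : ∀ y ∈ S.erase x, x < y := fun y hy =>
      lt_of_le_of_ne (S.min'_le y (Finset.mem_of_mem_erase hy)) (Finset.ne_of_mem_erase hy).symm
    have hcard := Finset.card_filter_add_card_filter_not (s := S.erase x) (fun y => χ x y = true)
    rw [Finset.card_erase_of_mem hxS] at hcard
    have hpow : 2 ^ (s + 1) = 2 ^ s + 2 ^ s := by ring
    have key : ∀ (Q T : Finset α) (c : Bool) (q : ℕ), T ⊆ S.erase x → (∀ y ∈ T, χ x y = c) →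
        Q ⊆ T → Q.card = q → (∀ i ∈ Q, ∀ j ∈ Q, i < j → χ i j = c) →
        ∃ Q' ⊆ S, Q'.card = q + 1 ∧ ∀ i ∈ Q', ∀ j ∈ Q', i < j → χ i j = c := by
      intro Q T c q hT hTc hQ hq hQc
      refine ⟨insert x Q, ?_, ?_, ?_⟩
      · exact Finset.insert_subset hxS ((hQ.trans hT).trans (Finset.erase_subset _ _))
      · rw [Finset.card_insert_of_notMem, hq]
        intro hxQ
        exact Finset.notMem_erase x S (hT (hQ hxQ))
      · intro i hi j hj hij
        rcases Finset.mem_insert.1 hi with rfl | hi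
        · rcases Finset.mem_insert.1 hj with rfl | hj
          · exact absurd hij (lt_irrefl _)
          · exact hTc j (hQ hj)
        · rcases Finset.mem_insert.1 hj with rfl | hj
          · exact absurd hij (not_lt.2 (hmin i (hT (hQ hi))).le)
          · exact hQc i hi j hj hij
    by_cases hlarge : 2 ^ s ≤ ((S.erase x).filter (fun y => χ x y = true)).card
    · rcases ih (a - 1) b (by omega) _ hlarge with ⟨Q, hQ, hq, hc⟩ | ⟨Q, hQ, hq, hc⟩
      · left
        have := key Q _ true (a - 1) (Finset.filter_subset _ _)
          (fun y hy => (Finset.mem_filter.1 hy).2) hQ hq hc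
        rwa [Nat.sub_add_cancel ha] at this
      · exact Or.inr ⟨Q, hQ.trans ((Finset.filter_subset _ _).trans (Finset.erase_subset _ _)),
          hq, hc⟩
    · have hlarge' : 2 ^ s ≤ ((S.erase x).filter (fun y => ¬ χ x y = true)).card := by omega
      rcases ih a (b - 1) (by omega) _ hlarge' with ⟨Q, hQ, hq, hc⟩ | ⟨Q, hQ, hq, hc⟩
      · exact Or.inl ⟨Q, hQ.trans ((Finset.filter_subset _ _).trans (Finset.erase_subset _ _)),
          hq, hc⟩
      · right
        have := key Q _ false (b - 1) (Finset.filter_subset _ _)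
          (fun y hy => by simpa using (Finset.mem_filter.1 hy).2) hQ hq hc
        rwa [Nat.sub_add_cancel hb] at this

theorem exists_homogeneous_pairs {α : Type*} [LinearOrder α] (χ : α → α → Bool) (n : ℕ)
    (S : Finset α) (hS : 4 ^ n ≤ S.card) :
    ∃ Q ⊆ S, Q.card = n ∧ ∃ c, ∀ i ∈ Q, ∀ j ∈ Q, i < j → χ i j = c := by
  have h4 : 2 ^ (n + n) ≤ S.card := by
    rwa [← two_mul, pow_mul]
  rcases exists_homogeneous_pairs_aux χ _ n n rfl S h4 with ⟨Q, hQ, hq, hc⟩ | ⟨Q, hQ, hq, hc⟩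
  · exact ⟨Q, hQ, hq, true, hc⟩
  · exact ⟨Q, hQ, hq, false, hc⟩

/-- One step of the Erdős–Rado argument, iterated `r` times: the sequence `Q` already chosen is
end-extended by `r` elements of the reservoir `U`. -/
theorem exists_endHomogeneous_aux {α : Type*} [LinearOrder α] (col : α → α → α → Bool) (m : ℕ) :
    ∀ (r : ℕ) (Q U : Finset α) (χ : α → α → Bool), Q.card + r = m → 2 ^ (r * m) ≤ U.card →
      (∀ i ∈ Q, ∀ k ∈ U, i < k) →
      (∀ i ∈ Q, ∀ j ∈ Q, i < j → ∀ k ∈ Q ∪ U, j < k → col i j k = χ i j) →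
      ∃ (R : Finset α) (χ' : α → α → Bool), R ⊆ Q ∪ U ∧ R.card = m ∧
        ∀ i ∈ R, ∀ j ∈ R, ∀ k ∈ R, i < j → j < k → col i j k = χ' i j := by
  classical
  intro r
  induction r with
  | zero =>
    intro Q U χ hm _ _ hcol
    exact ⟨Q, χ, Finset.subset_union_left, by simpa using hm, fun i hi j hj k hk hij hjk =>
      hcol i hi j hj hij k (Finset.mem_union_left _ hk) hjk⟩
  | succ r ih =>
    intro Q U χ hm hU hQU hcol
    have hne : U.Nonempty := Finset.card_pos.1 (lt_of_lt_of_le (by positivity) hU)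
    set x := U.min' hne with hx
    have hxU : x ∈ U := U.min'_mem hne
    have hmin : ∀ y ∈ U.erase x, x < y := fun y hy =>
      lt_of_le_of_ne (U.min'_le y (Finset.mem_of_mem_erase hy)) (Finset.ne_of_mem_erase hy).symm
    -- pigeonhole on the pattern of the colours `col i x k`, `i ∈ Q`
    obtain ⟨pat, -, hpat⟩ : ∃ pat ∈ (Finset.univ : Finset (Q → Bool)), 2 ^ (r * m) ≤
        ((U.erase x).filter (fun k => (fun i : Q => col i x k) = pat)).card := by
      by_contra! hcon
      have h1 := Finset.card_eq_sum_card_fiberwise (s := U.erase x)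
        (t := (Finset.univ : Finset (Q → Bool))) (f := fun k => (fun i : Q => col i x k))
        (by intro k _; simp)
      have h2 : ∑ pat : Q → Bool,
          ((U.erase x).filter (fun k => (fun i : Q => col i x k) = pat)).card ≤
          ∑ _pat : Q → Bool, (2 ^ (r * m) - 1) :=
        Finset.sum_le_sum fun pat hp => Nat.le_sub_one_of_lt (hcon pat hp)
      rw [← h1, Finset.card_erase_of_mem hxU] at h2
      simp only [Finset.sum_const, Finset.card_univ, Fintype.card_fun, Fintype.card_bool,
        Fintype.card_coe, smul_eq_mul] at h2
      have h3 : 2 ^ Q.card * 2 ^ (r * m) ≤ 2 ^ ((r + 1) * m) := by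
        rw [← pow_add]
        exact Nat.pow_le_pow_right (by norm_num) (by nlinarith)
      have h4 : 1 ≤ 2 ^ Q.card := Nat.one_le_two_pow
      have h5 : 1 ≤ 2 ^ (r * m) := Nat.one_le_two_pow
      have h6 : 2 ≤ 2 ^ ((r + 1) * m) := by
        calc 2 = 2 ^ 1 := rfl
          _ ≤ _ := Nat.pow_le_pow_right (by norm_num) (by nlinarith)
      rw [Nat.mul_sub] at h2
      by_cases hq : Q.card = 0
      · have h7 : 2 ^ (r * m) * 2 ≤ 2 ^ ((r + 1) * m) := by
          rw [← pow_succ]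
          exact Nat.pow_le_pow_right (by norm_num) (by nlinarith)
        rw [hq] at h2
        omega
      · have h7 : 2 ≤ 2 ^ Q.card := by
          calc 2 = 2 ^ 1 := rfl
            _ ≤ _ := Nat.pow_le_pow_right (by norm_num) (by omega)
        have h8 : 2 ^ Q.card * 1 ≤ 2 ^ Q.card * 2 ^ (r * m) := Nat.mul_le_mul_left _ h5
        omega
    set U' := (U.erase x).filter (fun k => (fun i : Q => col i x k) = pat) with hU'
    have hxQ : x ∉ Q := fun h => lt_irrefl _ (hQU x h x hxU)
    have hU'U : U' ⊆ U := (Finset.filter_subset _ _).trans (Finset.erase_subset _ _)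
    have hsub : insert x Q ∪ U' ⊆ Q ∪ U := by
      intro y hy
      simp only [Finset.mem_union, Finset.mem_insert] at hy ⊢
      rcases hy with (rfl | hy) | hy
      · exact Or.inr hxU
      · exact Or.inl hy
      · exact Or.inr (hU'U hy)
    have hxU' : ∀ k ∈ U', x < k := fun k hk => hmin k (Finset.mem_filter.1 hk).1
    obtain ⟨R, χ', hR, hRm, hRc⟩ := ih (insert x Q) U'
      (fun i j => if j = x then (if h : i ∈ Q then pat ⟨i, h⟩ else true) else χ i j)
      (by rw [Finset.card_insert_of_notMem hxQ]; omega) hpat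
      (by
        intro i hi k hk
        rcases Finset.mem_insert.1 hi with rfl | hi
        · exact hxU' k hk
        · exact hQU i hi k (hU'U hk))
      (by
        intro i hi j hj hij k hk hjk
        rcases Finset.mem_insert.1 hj with rfl | hj
        · rcases Finset.mem_insert.1 hi with rfl | hi
          · exact absurd hij (lt_irrefl _)
          · have hkU' : k ∈ U' := by
              rcases Finset.mem_union.1 hk with hk | hk
              · rcases Finset.mem_insert.1 hk with rfl | hk
                · exact absurd hjk (lt_irrefl _)
                · exact absurd hjk (not_lt.2 (hQU k hk _ hxU).le)
              · exact hk
            simp only [if_true, hi, dif_pos]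
            exact congrFun (Finset.mem_filter.1 hkU').2 ⟨i, hi⟩
        · have hjx : j ≠ x := fun h => hxQ (h ▸ hj)
          simp only [hjx, if_false]
          rcases Finset.mem_insert.1 hi with rfl | hi
          · exact absurd hij (not_lt.2 (hQU j hj _ hxU).le)
          · exact hcol i hi j hj hij k (hsub hk) hjk)
    exact ⟨R, χ', hR.trans hsub, hRm, hRc⟩

/-- Ramsey's theorem for ordered triples with the Erdős–Rado bound `2 ^ (16 ^ n)`. -/
theorem exists_homogeneous_triples {α : Type*} [LinearOrder α] (col : α → α → α → Bool) (n : ℕ)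
    (S : Finset α) (hS : 2 ^ 16 ^ n ≤ S.card) :
    ∃ Q ⊆ S, Q.card = n ∧ ∃ c, ∀ i ∈ Q, ∀ j ∈ Q, ∀ k ∈ Q, i < j → j < k → col i j k = c := by
  have h16 : 4 ^ n * 4 ^ n = 16 ^ n := by rw [← mul_pow]; norm_num
  obtain ⟨R, χ, hR, hRm, hRc⟩ := exists_endHomogeneous_aux col (4 ^ n) (4 ^ n) ∅ S
    (fun _ _ => true) (by simp) (by rwa [h16]) (by simp) (by simp)
  obtain ⟨Q, hQ, hQn, c, hc⟩ := exists_homogeneous_pairs χ n R hRm.ge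
  refine ⟨Q, by simpa using hQ.trans hR, hQn, c, fun i hi j hj k hk hij hjk => ?_⟩
  rw [hRc i (hQ hi) j (hQ hj) k (hQ hk) hij hjk]
  exact hc i hi j hj hij

theorem exists_strictMono_homogeneous_triples {V : Type*} [Fintype V] [LinearOrder V] {M : ℕ}
    (hM : 2 ^ 16 ^ Fintype.card V ≤ M) (col : Fin M → Fin M → Fin M → Bool) :
    ∃ (ψ : V → Fin M) (c : Bool), StrictMono ψ ∧
      ∀ i j k, i < j → j < k → col (ψ i) (ψ j) (ψ k) = c := by
  obtain ⟨Q, -, hQ, c, hc⟩ := exists_homogeneous_triples col (Fintype.card V) Finset.univ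
    (by simpa using hM)
  let o := (Fintype.orderIsoFinOfCardEq V rfl).symm.trans (Q.orderIsoOfFin hQ)
  refine ⟨fun v => o v, c, fun a b hab => o.strictMono hab, fun i j k hij hjk => ?_⟩
  exact hc _ (o i).2 _ (o j).2 _ (o k).2 (o.strictMono hij) (o.strictMono hjk)

/-! ### Weak regularity for functions of three variables -/

open Classical in
/-- The average of `f` over the cell `q ⁻¹ {l}` (zero if the cell is empty). -/
noncomputable def cellMean {Ω L : Type*} [Fintype Ω] (q : Ω → L) (f : Ω → ℝ)
    (l : L) : ℝ :=
  (∑ ω with q ω = l, f ω) / (Finset.univ.filter (fun ω => q ω = l)).card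

section cellMean

variable {Ω L L' : Type*} [Fintype Ω]

theorem cellMean_mem_Icc (q : Ω → L) (f : Ω → ℝ) (hf : ∀ ω, f ω ∈ Set.Icc (0 : ℝ) 1) (l : L) :
    cellMean q f l ∈ Set.Icc (0 : ℝ) 1 := by
  classical
  unfold cellMean
  refine ⟨div_nonneg (Finset.sum_nonneg fun ω _ => (hf ω).1) (Nat.cast_nonneg _), ?_⟩
  refine div_le_one_of_le₀ ?_ (Nat.cast_nonneg _)
  calc ∑ ω with q ω = l, f ω ≤ ∑ ω with q ω = l, (1 : ℝ) :=
        Finset.sum_le_sum fun ω _ => (hf ω).2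
    _ = _ := by simp

/-- Averaging over cells is self-adjoint: it does not change the correlation with a function that
is constant on the cells. -/
theorem sum_cellMean_mul (q : Ω → L) (f : Ω → ℝ) (h : L → ℝ) :
    ∑ ω, cellMean q f (q ω) * h (q ω) = ∑ ω, f ω * h (q ω) := by
  classical
  have hmaps : ∀ ω ∈ (Finset.univ : Finset Ω), q ω ∈ Finset.univ.image q :=
    fun ω _ => Finset.mem_image_of_mem q (Finset.mem_univ ω)
  rw [← Finset.sum_fiberwise_of_maps_to hmaps, ← Finset.sum_fiberwise_of_maps_to hmaps]
  refine Finset.sum_congr rfl fun l hl => ?_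
  obtain ⟨ω₀, -, hω₀⟩ := Finset.mem_image.1 hl
  have hpos : ((Finset.univ.filter (fun ω => q ω = l)).card : ℝ) ≠ 0 := by
    have : 0 < (Finset.univ.filter (fun ω => q ω = l)).card :=
      Finset.card_pos.2 ⟨ω₀, by simpa using hω₀⟩
    positivity
  have h1 : ∀ g : Ω → ℝ, ∑ ω with q ω = l, g ω * h (q ω) = (∑ ω with q ω = l, g ω) * h l := by
    intro g
    rw [Finset.sum_mul]
    refine Finset.sum_congr rfl fun ω hω => ?_
    rw [(Finset.mem_filter.1 hω).2]
  have h2 : ∑ ω with q ω = l, cellMean q f (q ω) * h (q ω) =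
      ∑ ω with q ω = l, cellMean q f l * h l := by
    refine Finset.sum_congr rfl fun ω hω => ?_
    rw [(Finset.mem_filter.1 hω).2]
  rw [h2, h1 f, Finset.sum_const, nsmul_eq_mul, cellMean]
  field_simp

/-- The energy of a partition grows under refinement by the squared distance of the averages. -/
theorem sum_sq_cellMean_refine (q : Ω → L) (q' : Ω → L') (r : L' → L) (hr : ∀ ω, r (q' ω) = q ω)
    (f : Ω → ℝ) :
    ∑ ω, (cellMean q' f (q' ω) - cellMean q f (q ω)) ^ 2 =
      ∑ ω, cellMean q' f (q' ω) ^ 2 - ∑ ω, cellMean q f (q ω) ^ 2 := by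
  have h1 : ∑ ω, cellMean q' f (q' ω) * cellMean q f (q ω) = ∑ ω, cellMean q f (q ω) ^ 2 := by
    have e1 := sum_cellMean_mul q' f (fun l => cellMean q f (r l))
    have e2 := sum_cellMean_mul q f (cellMean q f)
    simp only [hr] at e1
    rw [e1, ← e2]
    exact Finset.sum_congr rfl fun ω _ => (sq _).symm
  have h2 : ∀ ω, (cellMean q' f (q' ω) - cellMean q f (q ω)) ^ 2 =
      cellMean q' f (q' ω) ^ 2 - 2 * (cellMean q' f (q' ω) * cellMean q f (q ω)) +
        cellMean q f (q ω) ^ 2 := fun ω => by ring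
  simp only [h2, Finset.sum_add_distrib, Finset.sum_sub_distrib, ← Finset.mul_sum, h1]
  ring

/-- A set that is a union of cells of a refinement and on which `f` deviates from its cell average
forces an energy increment. -/
theorem sq_sum_sub_cellMean_le (q : Ω → L) (q' : Ω → L') (r : L' → L) (hr : ∀ ω, r (q' ω) = q ω)
    (f : Ω → ℝ) (h : L' → ℝ) (hh : ∀ l, h l ^ 2 ≤ 1) :
    (∑ ω, (f ω - cellMean q f (q ω)) * h (q' ω)) ^ 2 ≤
      Fintype.card Ω *
        (∑ ω, cellMean q' f (q' ω) ^ 2 - ∑ ω, cellMean q f (q ω) ^ 2) := by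
  have h1 : ∑ ω, (f ω - cellMean q f (q ω)) * h (q' ω) =
      ∑ ω, h (q' ω) * (cellMean q' f (q' ω) - cellMean q f (q ω)) := by
    have e := sum_cellMean_mul q' f h
    have : ∀ ω, h (q' ω) * (cellMean q' f (q' ω) - cellMean q f (q ω)) =
      cellMean q' f (q' ω) * h (q' ω) - cellMean q f (q ω) * h (q' ω) := fun ω => by ring
    simp only [this, sub_mul, Finset.sum_sub_distrib, e]
  rw [h1, ← sum_sq_cellMean_refine q q' r hr f]
  refine (Finset.sum_mul_sq_le_sq_mul_sq _ _ _).trans ?_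
  refine mul_le_mul_of_nonneg_right ?_ (Finset.sum_nonneg fun ω _ => sq_nonneg _)
  calc ∑ ω, h (q' ω) ^ 2 ≤ ∑ _ω : Ω, (1 : ℝ) := Finset.sum_le_sum fun ω _ => hh _
    _ = Fintype.card Ω := by simp

end cellMean

/-- The partition of `W × W × W` into boxes that is induced by a partition of `W`. -/
def boxCell {W K : Type*} (p : W → K) (ω : W × W × W) : K × K × K :=
  (p ω.1, p ω.2.1, p ω.2.2)

/-- Weak (Frieze–Kannan) regularity lemma, for two functions of three variables at once: up to
`ε` in cut norm both are constant on the boxes of a partition of bounded size. -/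
theorem exists_weakRegular_partition {W : Type*} [Fintype W] [Nonempty W]
    (f : Bool → W × W × W → ℝ) (hf : ∀ c ω, f c ω ∈ Set.Icc (0 : ℝ) 1) (ε : ℝ) (hε : 0 < ε)
    (k : ℕ) (hk : 2 < k * ε ^ 2) :
    ∃ (K : Type) (_ : Fintype K) (p : W → K), Fintype.card K ≤ 8 ^ k ∧
      ∀ (c : Bool) (A B C : Finset W),
        |∑ ω ∈ A ×ˢ B ×ˢ C, (f c ω - cellMean (boxCell p) (f c) (boxCell p ω))| ≤
          ε * (Fintype.card W : ℝ) ^ 3 := by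
  classical
  by_contra! hcon
  have hcardΩ : (Fintype.card (W × W × W) : ℝ) = (Fintype.card W : ℝ) ^ 3 := by
    simp [Fintype.card_prod]; ring
  have hW : (0 : ℝ) < Fintype.card W := by exact_mod_cast Fintype.card_pos
  -- each failure of the conclusion raises the energy by `ε ^ 2 * |W| ^ 3`
  have main : ∀ j ≤ k, ∃ (K : Type) (_ : Fintype K) (p : W → K),
      Fintype.card K ≤ 8 ^ j ∧ j * ε ^ 2 * (Fintype.card W : ℝ) ^ 3 ≤
        ∑ c, ∑ ω, cellMean (boxCell p) (f c) (boxCell p ω) ^ 2 := by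
    intro j
    induction j with
    | zero =>
      intro _
      refine ⟨Unit, inferInstance, fun _ => (), by simp, ?_⟩
      simp only [Nat.cast_zero, zero_mul]
      exact Finset.sum_nonneg fun c _ => Finset.sum_nonneg fun ω _ => sq_nonneg _
    | succ j ih =>
      intro hj
      obtain ⟨K, iF, p, hK, hE⟩ := ih (by omega)
      obtain ⟨c, A, B, C, hABC⟩ := hcon K iF p
        (hK.trans (Nat.pow_le_pow_right (by norm_num) (by omega)))
      let p' : W → K × Bool × Bool × Bool :=
        fun x => (p x, decide (x ∈ A), decide (x ∈ B), decide (x ∈ C))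
      let r : (K × Bool × Bool × Bool) × (K × Bool × Bool × Bool) × (K × Bool × Bool × Bool) →
        K × K × K := fun l => (l.1.1, l.2.1.1, l.2.2.1)
      have hr : ∀ ω, r (boxCell p' ω) = boxCell p ω := fun ω => rfl
      have hmono : ∀ c', ∑ ω, cellMean (boxCell p) (f c') (boxCell p ω) ^ 2 ≤
          ∑ ω, cellMean (boxCell p') (f c') (boxCell p' ω) ^ 2 := by
        intro c'
        have := sum_sq_cellMean_refine (boxCell p) (boxCell p') r hr (f c')
        have h0 : 0 ≤ ∑ ω, (cellMean (boxCell p') (f c') (boxCell p' ω) -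
            cellMean (boxCell p) (f c') (boxCell p ω)) ^ 2 :=
          Finset.sum_nonneg fun ω _ => sq_nonneg _
        linarith
      let h : (K × Bool × Bool × Bool) × (K × Bool × Bool × Bool) × (K × Bool × Bool × Bool) → ℝ :=
        fun l => if l.1.2.1 = true ∧ l.2.1.2.2.1 = true ∧ l.2.2.2.2.2 = true then 1 else 0
      have hh : ∀ l, h l ^ 2 ≤ 1 := by
        intro l
        simp only [h]
        split_ifs <;> norm_num
      have hsum : ∑ ω, (f c ω - cellMean (boxCell p) (f c) (boxCell p ω)) * h (boxCell p' ω) =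
          ∑ ω ∈ A ×ˢ B ×ˢ C, (f c ω - cellMean (boxCell p) (f c) (boxCell p ω)) := by
        rw [← Finset.sum_filter_add_sum_filter_not Finset.univ (fun ω => ω ∈ A ×ˢ B ×ˢ C)]
        rw [Finset.sum_eq_zero (s := Finset.univ.filter (fun ω => ¬ ω ∈ A ×ˢ B ×ˢ C)), add_zero]
        · rw [Finset.filter_mem_eq_inter, Finset.univ_inter]
          refine Finset.sum_congr rfl fun ω hω => ?_
          have : h (boxCell p' ω) = 1 := by
            simp only [Finset.mem_product] at hω
            simp [h, boxCell, p', hω]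
          rw [this, mul_one]
        · intro ω hω
          have : h (boxCell p' ω) = 0 := by
            simp only [Finset.mem_filter, Finset.mem_univ, true_and, Finset.mem_product] at hω
            simp only [h, boxCell, p', decide_eq_true_eq]
            rw [if_neg hω]
          rw [this, mul_zero]
      have hinc := sq_sum_sub_cellMean_le (boxCell p) (boxCell p') r hr (f c) h hh
      rw [hsum, hcardΩ] at hinc
      have hsq : (ε * (Fintype.card W : ℝ) ^ 3) ^ 2 <
          (∑ ω ∈ A ×ˢ B ×ˢ C, (f c ω - cellMean (boxCell p) (f c) (boxCell p ω))) ^ 2 := by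
        rw [← sq_abs (∑ ω ∈ A ×ˢ B ×ˢ C, _)]
        exact pow_lt_pow_left₀ hABC (by positivity) (by norm_num)
      have hgain : ε ^ 2 * (Fintype.card W : ℝ) ^ 3 ≤
          ∑ ω, cellMean (boxCell p') (f c) (boxCell p' ω) ^ 2 -
            ∑ ω, cellMean (boxCell p) (f c) (boxCell p ω) ^ 2 := by
        have h3 : (0 : ℝ) < (Fintype.card W : ℝ) ^ 3 := by positivity
        have h4 := hsq.le.trans hinc
        have h5 : (ε * (Fintype.card W : ℝ) ^ 3) ^ 2 =
          (Fintype.card W : ℝ) ^ 3 * (ε ^ 2 * (Fintype.card W : ℝ) ^ 3) := by ring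
        rw [h5] at h4
        exact le_of_mul_le_mul_left h4 h3
      have hE' : ((j + 1 : ℕ) : ℝ) * ε ^ 2 * (Fintype.card W : ℝ) ^ 3 ≤
          ∑ c, ∑ ω, cellMean (boxCell p') (f c) (boxCell p' ω) ^ 2 := by
        have ht := hmono true
        have hfl := hmono false
        simp only [Fintype.sum_bool] at hE ⊢
        push_cast
        cases c <;> linarith
      refine ⟨K × Bool × Bool × Bool, inferInstance, p', ?_, hE'⟩
      simp only [Fintype.card_prod, Fintype.card_bool]
      rw [pow_succ]
      omega
  obtain ⟨K, iF, p, -, hE⟩ := main k le_rfl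
  have hub : ∑ c, ∑ ω, cellMean (boxCell p) (f c) (boxCell p ω) ^ 2 ≤
      2 * (Fintype.card W : ℝ) ^ 3 := by
    have : ∀ c, ∑ ω, cellMean (boxCell p) (f c) (boxCell p ω) ^ 2 ≤
        (Fintype.card W : ℝ) ^ 3 := by
      intro c
      calc ∑ ω, cellMean (boxCell p) (f c) (boxCell p ω) ^ 2 ≤ ∑ _ω : W × W × W, (1 : ℝ) := by
            refine Finset.sum_le_sum fun ω _ => ?_
            have := cellMean_mem_Icc (boxCell p) (f c) (hf c) (boxCell p ω)
            exact pow_le_one₀ this.1 this.2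
        _ = _ := by rw [← hcardΩ]; simp
    have ht := this true
    have hfl := this false
    simp only [Fintype.sum_bool]
    linarith
  have h3 : (0 : ℝ) < (Fintype.card W : ℝ) ^ 3 := by positivity
  nlinarith

/-! ### Replacing one factor of a linear system at a time -/

section counting

variable {V W : Type*} [Fintype V] [DecidableEq V] [Fintype W]

/-- Resampling one coordinate preserves averages. -/
theorem sum_sum_update (i : V) (Φ : (V → W) → ℝ) :
    ∑ z : V → W, ∑ x, Φ (Function.update z i x) = Fintype.card W * ∑ z, Φ z := by
  have hinv : Function.Involutive
      (fun q : (V → W) × W => (Function.update q.1 i q.2, q.1 i)) := by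
    rintro ⟨z, x⟩
    simp
  have h := Equiv.sum_comp hinv.toPerm (fun q : (V → W) × W => Φ q.1)
  simp only [Function.Involutive.coe_toPerm, Fintype.sum_prod_type] at h
  rw [h]
  simp [Finset.mul_sum]

/-- `D`, a function of the coordinates in `e`, has small correlation with every product of
weights each of which involves at most one of the coordinates in `e`. -/
def BoxSmall (e : Finset V) (D : (V → W) → ℝ) (δ : ℝ) : Prop :=
  ∀ a : V → (V → W) → ℝ, (∀ v z, a v z ∈ Set.Icc (0 : ℝ) 1) →
    (∀ v ∈ e, DependsOn (a v) ((e.erase v : Finset V) : Set V)ᶜ) →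
    |∑ z, D z * ∏ v ∈ e, a v z| ≤ δ * (Fintype.card W : ℝ) ^ Fintype.card V

/-- Counting lemma for linear systems: if the index sets `e ∈ E` pairwise share at most one
coordinate, then factors that are close in the sense of `BoxSmall` may be exchanged in a product
over `E`. Linearity enters because each other factor sees at most one coordinate of `e`. -/
theorem abs_sum_prod_sub_sum_prod_le (E : Finset (Finset V)) (hne : ∀ e ∈ E, e.Nonempty)
    (hlin : ∀ e ∈ E, ∀ e' ∈ E, e ≠ e' → ((e : Set V) ∩ e').Subsingleton)
    (u v : Finset V → (V → W) → ℝ)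
    (hu : ∀ e z, u e z ∈ Set.Icc (0 : ℝ) 1) (hv : ∀ e z, v e z ∈ Set.Icc (0 : ℝ) 1)
    (hud : ∀ e ∈ E, DependsOn (u e) (e : Set V)) (hvd : ∀ e ∈ E, DependsOn (v e) (e : Set V))
    (δ : ℝ) (hδ : ∀ e ∈ E, BoxSmall e (fun z => u e z - v e z) δ) :
    |∑ z, ∏ e ∈ E, u e z - ∑ z, ∏ e ∈ E, v e z| ≤
      E.card * (δ * (Fintype.card W : ℝ) ^ Fintype.card V) := by
  classical
  -- `hyb A` uses `u` on `A` and `v` elsewhere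
  let hyb : Finset (Finset V) → Finset V → (V → W) → ℝ := fun A e => if e ∈ A then u e else v e
  have hyb01 : ∀ A e z, hyb A e z ∈ Set.Icc (0 : ℝ) 1 := by
    intro A e z
    simp only [hyb]
    split_ifs
    exacts [hu e z, hv e z]
  have hybd : ∀ A, ∀ e ∈ E, DependsOn (hyb A e) (e : Set V) := by
    intro A e he
    simp only [hyb]
    split_ifs
    exacts [hud e he, hvd e he]
  have main : ∀ A ⊆ E, |∑ z, ∏ e ∈ E, hyb A e z - ∑ z, ∏ e ∈ E, v e z| ≤
      A.card * (δ * (Fintype.card W : ℝ) ^ Fintype.card V) := by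
    intro A
    induction A using Finset.induction_on with
    | empty => intro _; simp [hyb]
    | insert e A heA ih =>
      intro hA
      have heE : e ∈ E := hA (Finset.mem_insert_self e A)
      have ih' := ih ((Finset.subset_insert e A).trans hA)
      -- the other factors, grouped by the coordinate of `e` they may see
      obtain ⟨v₀, hv₀⟩ := hne e heE
      have hloc : ∀ e' : Finset V, ∃ w ∈ e, e' ∈ E.erase e → (e : Set V) ∩ e' ⊆ {w} := by
        intro e'
        by_cases he' : e' ∈ E.erase e
        · by_cases hem : ((e : Set V) ∩ e').Nonempty
          · obtain ⟨w, hw, hw'⟩ := hem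
            exact ⟨w, hw, fun _ y hy => hlin e heE e' (Finset.mem_of_mem_erase he')
              (Finset.ne_of_mem_erase he').symm hy ⟨hw, hw'⟩⟩
          · rw [Set.not_nonempty_iff_eq_empty] at hem
            exact ⟨v₀, hv₀, fun _ => by rw [hem]; exact Set.empty_subset _⟩
        · exact ⟨v₀, hv₀, fun h => absurd h he'⟩
      choose w hwe hw using hloc
      let a : V → (V → W) → ℝ := fun x z =>
        ∏ e' ∈ (E.erase e).filter (fun e' => w e' = x), hyb A e' z
      have ha01 : ∀ x z, a x z ∈ Set.Icc (0 : ℝ) 1 := fun x z =>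
        ⟨Finset.prod_nonneg fun e' _ => (hyb01 A e' z).1,
          Finset.prod_le_one (fun e' _ => (hyb01 A e' z).1) fun e' _ => (hyb01 A e' z).2⟩
      have had : ∀ x ∈ e, DependsOn (a x) ((e.erase x : Finset V) : Set V)ᶜ := by
        intro x hx z z' hzz
        refine Finset.prod_congr rfl fun e' he' => ?_
        obtain ⟨he'E, hwx⟩ := Finset.mem_filter.1 he'
        refine hybd A e' (Finset.mem_of_mem_erase he'E) fun y hy => hzz y ?_
        intro hye
        have hy' := Finset.mem_erase.1 (Finset.mem_coe.1 hye)
        have := hw e' he'E ⟨hy'.2, hy⟩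
        rw [hwx] at this
        exact hy'.1 this
      have hprod : ∀ z, ∏ x ∈ e, a x z = ∏ e' ∈ E.erase e, hyb A e' z := fun z =>
        Finset.prod_fiberwise_of_maps_to (fun e' _ => hwe e') _
      have hdiff : ∑ z, ∏ e' ∈ E, hyb (insert e A) e' z - ∑ z, ∏ e' ∈ E, hyb A e' z =
          ∑ z, (u e z - v e z) * ∏ x ∈ e, a x z := by
        rw [← Finset.sum_sub_distrib]
        refine Finset.sum_congr rfl fun z _ => ?_
        rw [hprod, ← Finset.mul_prod_erase E _ heE,
          ← Finset.mul_prod_erase E (fun e' => hyb A e' z) heE]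
        have h1 : ∏ e' ∈ E.erase e, hyb (insert e A) e' z = ∏ e' ∈ E.erase e, hyb A e' z := by
          refine Finset.prod_congr rfl fun e' he' => ?_
          simp [hyb, Finset.mem_insert, Finset.ne_of_mem_erase he']
        rw [h1]
        simp [hyb, heA]
        ring
      have hstep := hδ e heE a ha01 had
      rw [← hdiff] at hstep
      rw [Finset.card_insert_of_notMem heA]
      push_cast
      rw [abs_le] at *
      constructor <;> linarith [hstep.1, hstep.2, ih'.1, ih'.2]
  have := main E subset_rfl
  have hEu : ∀ z, ∏ e ∈ E, hyb E e z = ∏ e ∈ E, u e z := fun z =>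
    Finset.prod_congr rfl fun e he => by simp [hyb, he]
  simpa only [hEu] using this

/-- Cut-norm bounds give `BoxSmall` after freezing the coordinates outside the pair. -/
theorem boxSmall_pair {i j : V} (hij : i ≠ j) (d : W → W → ℝ) (δ : ℝ)
    (hd : ∀ a b : W → ℝ, (∀ x, a x ∈ Set.Icc (0 : ℝ) 1) → (∀ x, b x ∈ Set.Icc (0 : ℝ) 1) →
      |∑ x, ∑ y, d x y * (a x * b y)| ≤ δ * (Fintype.card W : ℝ) ^ 2) :
    BoxSmall ({i, j} : Finset V) (fun z : V → W => d (z i) (z j)) δ := by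
  intro a ha had
  rcases isEmpty_or_nonempty W with hW | hW
  · have : IsEmpty (V → W) := ⟨fun z => hW.elim (z i)⟩
    have hV : Fintype.card V ≠ 0 := (Fintype.card_pos_iff.2 ⟨i⟩).ne'
    simp [hV]
  have hWpos : (0 : ℝ) < Fintype.card W := by exact_mod_cast Fintype.card_pos
  set Φ : (V → W) → ℝ := fun z => d (z i) (z j) * ∏ v ∈ ({i, j} : Finset V), a v z with hΦ
  -- resample the coordinates `i` and `j`; for fixed `z` the weights separate
  have h1 : (Fintype.card W : ℝ) ^ 2 * ∑ z, Φ z =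
      ∑ z : V → W, ∑ x, ∑ y, Φ (Function.update (Function.update z i x) j y) := by
    rw [sum_sum_update i (fun z => ∑ y, Φ (Function.update z j y)), sum_sum_update j]
    ring
  have h2 : ∀ z : V → W,
      |∑ x, ∑ y, Φ (Function.update (Function.update z i x) j y)| ≤
        δ * (Fintype.card W : ℝ) ^ 2 := by
    intro z
    have := hd (fun x => a i (Function.update z i x)) (fun y => a j (Function.update z j y))
      (fun x => ha _ _) (fun x => ha _ _)
    convert this using 4 with x _ y _
    simp only [hΦ]
    rw [Finset.prod_pair hij]
    congr 1
    · simp [Function.update_of_ne hij]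
    · congr 1
      · refine had i (by simp) fun k hk => ?_
        have hkj : k ≠ j := by
          rintro rfl
          exact hk (by simp [hij.symm])
        rw [Function.update_of_ne hkj]
      · refine had j (by simp) fun k hk => ?_
        have hki : k ≠ i := by
          rintro rfl
          exact hk (by simp [hij])
        by_cases hkj : k = j
        · subst hkj; simp
        · simp [Function.update_of_ne hkj, Function.update_of_ne hki]
  have h3 : (Fintype.card W : ℝ) ^ 2 * |∑ z, Φ z| ≤
      (Fintype.card W : ℝ) ^ 2 * (δ * (Fintype.card W : ℝ) ^ Fintype.card V) := by
    have hsq : (0 : ℝ) < (Fintype.card W : ℝ) ^ 2 := by positivity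
    calc (Fintype.card W : ℝ) ^ 2 * |∑ z, Φ z|
        = |(Fintype.card W : ℝ) ^ 2 * ∑ z, Φ z| := by rw [abs_mul, abs_of_pos hsq]
      _ ≤ ∑ z : V → W, δ * (Fintype.card W : ℝ) ^ 2 := by
          rw [h1]
          exact (Finset.abs_sum_le_sum_abs _ _).trans (Finset.sum_le_sum fun z _ => h2 z)
      _ = _ := by
          simp only [Finset.sum_const, Finset.card_univ, Fintype.card_fun, nsmul_eq_mul]
          push_cast
          ring
  exact le_of_mul_le_mul_left h3 (by positivity)

theorem boxSmall_triple {i j k : V} (hij : i ≠ j) (hik : i ≠ k) (hjk : j ≠ k)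
    (d : W → W → W → ℝ) (δ : ℝ)
    (hd : ∀ a b c : W → ℝ, (∀ x, a x ∈ Set.Icc (0 : ℝ) 1) → (∀ x, b x ∈ Set.Icc (0 : ℝ) 1) →
      (∀ x, c x ∈ Set.Icc (0 : ℝ) 1) →
      |∑ x, ∑ y, ∑ t, d x y t * (a x * (b y * c t))| ≤ δ * (Fintype.card W : ℝ) ^ 3) :
    BoxSmall ({i, j, k} : Finset V) (fun z : V → W => d (z i) (z j) (z k)) δ := by
  intro a ha had
  rcases isEmpty_or_nonempty W with hW | hW
  · have : IsEmpty (V → W) := ⟨fun z => hW.elim (z i)⟩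
    have hV : Fintype.card V ≠ 0 := (Fintype.card_pos_iff.2 ⟨i⟩).ne'
    simp [hV]
  have hWpos : (0 : ℝ) < Fintype.card W := by exact_mod_cast Fintype.card_pos
  set Φ : (V → W) → ℝ :=
    fun z => d (z i) (z j) (z k) * ∏ v ∈ ({i, j, k} : Finset V), a v z with hΦ
  let up : (V → W) → W → W → W → V → W :=
    fun z x y t => Function.update (Function.update (Function.update z i x) j y) k t
  have h1 : (Fintype.card W : ℝ) ^ 3 * ∑ z, Φ z =
      ∑ z : V → W, ∑ x, ∑ y, ∑ t, Φ (up z x y t) := by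
    simp only [up]
    rw [sum_sum_update i (fun z => ∑ y, ∑ t, Φ (Function.update (Function.update z j y) k t)),
      sum_sum_update j (fun z => ∑ t, Φ (Function.update z k t)), sum_sum_update k]
    ring
  have hup : ∀ (z : V → W) x y t, up z x y t i = x ∧ up z x y t j = y ∧ up z x y t k = t ∧
      ∀ l, l ≠ i → l ≠ j → l ≠ k → up z x y t l = z l := by
    intro z x y t
    refine ⟨?_, ?_, ?_, fun l h1 h2 h3 => ?_⟩
    · simp [up, Function.update_of_ne hij, Function.update_of_ne hik]
    · simp [up, Function.update_of_ne hjk]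
    · simp [up]
    · simp [up, Function.update_of_ne h1, Function.update_of_ne h2, Function.update_of_ne h3]
  have h2 : ∀ z : V → W,
      |∑ x, ∑ y, ∑ t, Φ (up z x y t)| ≤ δ * (Fintype.card W : ℝ) ^ 3 := by
    intro z
    have := hd (fun x => a i (Function.update z i x)) (fun y => a j (Function.update z j y))
      (fun y => a k (Function.update z k y)) (fun x => ha _ _) (fun x => ha _ _) (fun x => ha _ _)
    convert this using 5 with x _ y _ t _
    obtain ⟨u1, u2, u3, u4⟩ := hup z x y t
    simp only [hΦ]
    rw [Finset.prod_insert (by simp [hij, hik]), Finset.prod_pair hjk, u1, u2, u3]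
    congr 2
    · refine had i (by simp) fun l hl => ?_
      have hlj : l ≠ j := by rintro rfl; exact hl (by simp [hij.symm])
      have hlk : l ≠ k := by rintro rfl; exact hl (by simp [hik.symm])
      by_cases hli : l = i
      · subst hli; simp [u1]
      · rw [u4 l hli hlj hlk, Function.update_of_ne hli]
    · congr 1
      · refine had j (by simp) fun l hl => ?_
        have hli : l ≠ i := by rintro rfl; exact hl (by simp [hij])
        have hlk : l ≠ k := by rintro rfl; exact hl (by simp [hjk.symm])
        by_cases hlj : l = j
        · subst hlj; simp [u2]
        · rw [u4 l hli hlj hlk, Function.update_of_ne hlj]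
      · refine had k (by simp) fun l hl => ?_
        have hli : l ≠ i := by rintro rfl; exact hl (by simp [hik])
        have hlj : l ≠ j := by rintro rfl; exact hl (by simp [hjk])
        by_cases hlk : l = k
        · subst hlk; simp [u3]
        · rw [u4 l hli hlj hlk, Function.update_of_ne hlk]
  have h3 : (Fintype.card W : ℝ) ^ 3 * |∑ z, Φ z| ≤
      (Fintype.card W : ℝ) ^ 3 * (δ * (Fintype.card W : ℝ) ^ Fintype.card V) := by
    have hsq : (0 : ℝ) < (Fintype.card W : ℝ) ^ 3 := by positivity
    calc (Fintype.card W : ℝ) ^ 3 * |∑ z, Φ z|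
        = |(Fintype.card W : ℝ) ^ 3 * ∑ z, Φ z| := by rw [abs_mul, abs_of_pos hsq]
      _ ≤ ∑ z : V → W, δ * (Fintype.card W : ℝ) ^ 3 := by
          rw [h1]
          exact (Finset.abs_sum_le_sum_abs _ _).trans (Finset.sum_le_sum fun z _ => h2 z)
      _ = _ := by
          simp only [Finset.sum_const, Finset.card_univ, Fintype.card_fun, nsmul_eq_mul]
          push_cast
          ring
  exact le_of_mul_le_mul_left h3 (by positivity)

end counting

/-! ### From sets to weights -/

/-- A linear functional on `[0, 1]`-valued weights is largest at an indicator function. -/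
theorem exists_sum_mul_le_sum {W : Type*} [Fintype W] (L a : W → ℝ)
    (ha : ∀ x, a x ∈ Set.Icc (0 : ℝ) 1) : ∃ A : Finset W, ∑ x, L x * a x ≤ ∑ x ∈ A, L x := by
  classical
  refine ⟨Finset.univ.filter (fun x => 0 < L x), ?_⟩
  rw [Finset.sum_filter]
  refine Finset.sum_le_sum fun x _ => ?_
  obtain ⟨h0, h1⟩ := ha x
  split_ifs with h
  · nlinarith
  · nlinarith

/-- Bounds for the sums over boxes extend to `[0, 1]`-valued weights, by multilinearity. -/
theorem sum_box_weights_le {W : Type*} [Fintype W] (d : W → W → W → ℝ) (B : ℝ)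
    (hd : ∀ A₁ A₂ A₃ : Finset W, ∑ x ∈ A₁, ∑ y ∈ A₂, ∑ t ∈ A₃, d x y t ≤ B) (a b c : W → ℝ)
    (ha : ∀ x, a x ∈ Set.Icc (0 : ℝ) 1) (hb : ∀ x, b x ∈ Set.Icc (0 : ℝ) 1)
    (hc : ∀ x, c x ∈ Set.Icc (0 : ℝ) 1) :
    ∑ x, ∑ y, ∑ t, d x y t * (a x * (b y * c t)) ≤ B := by
  obtain ⟨A₁, h₁⟩ := exists_sum_mul_le_sum (fun x => ∑ y, ∑ t, d x y t * (b y * c t)) a ha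
  obtain ⟨A₂, h₂⟩ := exists_sum_mul_le_sum (fun y => ∑ x ∈ A₁, ∑ t, d x y t * c t) b hb
  obtain ⟨A₃, h₃⟩ := exists_sum_mul_le_sum (fun t => ∑ x ∈ A₁, ∑ y ∈ A₂, d x y t) c hc
  calc ∑ x, ∑ y, ∑ t, d x y t * (a x * (b y * c t))
      = ∑ x, (∑ y, ∑ t, d x y t * (b y * c t)) * a x := by
        simp only [Finset.sum_mul]
        refine Finset.sum_congr rfl fun x _ => Finset.sum_congr rfl fun y _ =>
          Finset.sum_congr rfl fun t _ => by ring
    _ ≤ ∑ x ∈ A₁, ∑ y, ∑ t, d x y t * (b y * c t) := h₁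
    _ = ∑ y, (∑ x ∈ A₁, ∑ t, d x y t * c t) * b y := by
        rw [Finset.sum_comm]
        simp only [Finset.sum_mul]
        refine Finset.sum_congr rfl fun y _ => Finset.sum_congr rfl fun x _ =>
          Finset.sum_congr rfl fun t _ => by ring
    _ ≤ ∑ y ∈ A₂, ∑ x ∈ A₁, ∑ t, d x y t * c t := h₂
    _ = ∑ t, (∑ x ∈ A₁, ∑ y ∈ A₂, d x y t) * c t := by
        simp only [Finset.sum_mul]
        rw [Finset.sum_comm]
        simp_rw [Finset.sum_comm (s := A₂)]
        rw [Finset.sum_comm]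
    _ ≤ ∑ t ∈ A₃, ∑ x ∈ A₁, ∑ y ∈ A₂, d x y t := h₃
    _ = ∑ x ∈ A₁, ∑ y ∈ A₂, ∑ t ∈ A₃, d x y t := by
        rw [Finset.sum_comm]
        refine Finset.sum_congr rfl fun x _ => Finset.sum_comm
    _ ≤ B := hd A₁ A₂ A₃

theorem abs_sum_box_weights_le {W : Type*} [Fintype W] (d : W → W → W → ℝ) (B : ℝ)
    (hd : ∀ A₁ A₂ A₃ : Finset W, |∑ x ∈ A₁, ∑ y ∈ A₂, ∑ t ∈ A₃, d x y t| ≤ B) (a b c : W → ℝ)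
    (ha : ∀ x, a x ∈ Set.Icc (0 : ℝ) 1) (hb : ∀ x, b x ∈ Set.Icc (0 : ℝ) 1)
    (hc : ∀ x, c x ∈ Set.Icc (0 : ℝ) 1) :
    |∑ x, ∑ y, ∑ t, d x y t * (a x * (b y * c t))| ≤ B := by
  rw [abs_le']
  refine ⟨sum_box_weights_le d B (fun A₁ A₂ A₃ => (le_abs_self _).trans (hd A₁ A₂ A₃)) a b c
    ha hb hc, ?_⟩
  have := sum_box_weights_le (fun x y t => - d x y t) B (fun A₁ A₂ A₃ => by
    simp only [Finset.sum_neg_distrib]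
    exact (neg_le_abs _).trans (hd A₁ A₂ A₃)) a b c ha hb hc
  simpa only [neg_mul, Finset.sum_neg_distrib] using this

/-! ### A quasirandom graph on `2 ^ (2 * r)` vertices -/

/-- A symmetric Hadamard matrix of order `2 ^ m` (the character table of an elementary abelian
`2`-group). -/
theorem exists_symmetric_hadamard (m : ℕ) : ∃ χ : Fin (2 ^ m) → Fin (2 ^ m) → ℝ,
    (∀ x y, χ x y = χ y x) ∧ (∀ x y, χ x y = 1 ∨ χ x y = -1) ∧
    ∀ y y', ∑ x, χ x y * χ x y' = if y = y' then (2 : ℝ) ^ m else 0 := by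
  classical
  let e : Fin (2 ^ m) ≃ (Fin m → Bool) := (Fintype.equivFinOfCardEq (by simp)).symm
  let s : Bool → Bool → ℝ := fun a b => if a && b then -1 else 1
  have hs : ∀ a b, s a b = s b a := fun a b => by cases a <;> cases b <;> rfl
  have hs1 : ∀ a b, s a b = 1 ∨ s a b = -1 := by
    intro a b; cases a <;> cases b <;> simp [s]
  refine ⟨fun x y => ∏ i, s (e x i) (e y i), fun x y => ?_, fun x y => ?_, fun y y' => ?_⟩
  · exact Finset.prod_congr rfl fun i _ => hs _ _
  · refine Finset.prod_induction _ (fun t : ℝ => t = 1 ∨ t = -1) ?_ (Or.inl rfl)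
      (fun i _ => hs1 _ _)
    rintro a b (rfl | rfl) (rfl | rfl) <;> norm_num
  · rw [Equiv.sum_comp e (fun w => (∏ i, s (w i) (e y i)) * ∏ i, s (w i) (e y' i))]
    simp only [← Finset.prod_mul_distrib]
    have h1 := Finset.prod_univ_sum (fun _ : Fin m => (Finset.univ : Finset Bool))
      (fun i b => s b (e y i) * s b (e y' i))
    rw [Fintype.piFinset_univ] at h1
    rw [← h1]
    have h2 : ∀ a b : Bool, ∑ c, s c a * s c b = if a = b then 2 else 0 := by
      intro a b; cases a <;> cases b <;> norm_num [s]
    simp only [h2]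
    split_ifs with h
    · subst h
      simp
    · obtain ⟨i, hi⟩ : ∃ i, e y i ≠ e y' i := by
        by_contra! hcon
        exact h (e.injective (funext hcon))
      exact Finset.prod_eq_zero (Finset.mem_univ i) (if_neg hi)

/-- Lindsey's lemma, for weights. -/
theorem sq_sum_hadamard_le {W : Type*} [Fintype W] [DecidableEq W] (χ : W → W → ℝ)
    (hχ : ∀ y y', ∑ x, χ x y * χ x y' = if y = y' then (Fintype.card W : ℝ) else 0)
    (a b : W → ℝ) (ha : ∀ x, a x ∈ Set.Icc (0 : ℝ) 1) (hb : ∀ x, b x ∈ Set.Icc (0 : ℝ) 1) :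
    (∑ x, ∑ y, χ x y * (a x * b y)) ^ 2 ≤ (Fintype.card W : ℝ) ^ 3 := by
  have hle : ∀ c : W → ℝ, (∀ x, c x ∈ Set.Icc (0 : ℝ) 1) → ∑ x, c x ^ 2 ≤ Fintype.card W := by
    intro c hc
    calc ∑ x, c x ^ 2 ≤ ∑ _x : W, (1 : ℝ) :=
          Finset.sum_le_sum fun x _ => pow_le_one₀ (hc x).1 (hc x).2
      _ = _ := by simp
  have h1 : ∑ x, ∑ y, χ x y * (a x * b y) = ∑ x, a x * ∑ y, χ x y * b y := by
    refine Finset.sum_congr rfl fun x _ => ?_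
    rw [Finset.mul_sum]
    exact Finset.sum_congr rfl fun y _ => by ring
  have h2 : ∑ x, (∑ y, χ x y * b y) ^ 2 = Fintype.card W * ∑ y, b y ^ 2 := by
    calc ∑ x, (∑ y, χ x y * b y) ^ 2
        = ∑ x, ∑ y, ∑ y', b y * b y' * (χ x y * χ x y') := by
          refine Finset.sum_congr rfl fun x _ => ?_
          rw [sq, Finset.sum_mul_sum]
          exact Finset.sum_congr rfl fun y _ => Finset.sum_congr rfl fun y' _ => by ring
      _ = ∑ y, ∑ y', b y * b y' * ∑ x, χ x y * χ x y' := by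
          rw [Finset.sum_comm]
          refine Finset.sum_congr rfl fun y _ => ?_
          rw [Finset.sum_comm]
          refine Finset.sum_congr rfl fun y' _ => ?_
          rw [Finset.mul_sum]
      _ = _ := by
          simp only [hχ, mul_ite, mul_zero, Finset.sum_ite_eq, Finset.mem_univ, if_true,
            Finset.mul_sum]
          exact Finset.sum_congr rfl fun y _ => by ring
  have hN : (0 : ℝ) ≤ Fintype.card W := Nat.cast_nonneg _
  rw [h1]
  refine (Finset.sum_mul_sq_le_sq_mul_sq _ _ _).trans ?_
  rw [h2]
  calc (∑ x, a x ^ 2) * (Fintype.card W * ∑ y, b y ^ 2)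
      ≤ Fintype.card W * (Fintype.card W * Fintype.card W) := by
        gcongr
        · exact hle a ha
        · exact hle b hb
    _ = _ := by ring

open Classical in
/-- The indicator function of `G.Adj` (for `b = true`), or of being distinct and not adjacent
(for `b = false`). -/
noncomputable def adjIndicator {W : Type*} (G : SimpleGraph W) (b : Bool) (x y : W) : ℝ :=
  if x ≠ y ∧ (G.Adj x y ↔ b = true) then 1 else 0

theorem adjIndicator_mem_Icc {W : Type*} (G : SimpleGraph W) (b : Bool) (x y : W) :
    adjIndicator G b x y ∈ Set.Icc (0 : ℝ) 1 := by
  unfold adjIndicator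
  split_ifs <;> simp

/-- Both `G` and its complement have density `1 / 2` between any two sets (or weights), up to an
error of `δ` in cut norm. -/
def IsQuasirandom {W : Type*} [Fintype W] (G : SimpleGraph W) (δ : ℝ) : Prop :=
  ∀ (b : Bool) (u v : W → ℝ), (∀ x, u x ∈ Set.Icc (0 : ℝ) 1) → (∀ x, v x ∈ Set.Icc (0 : ℝ) 1) →
    |∑ x, ∑ y, (adjIndicator G b x y - 1 / 2) * (u x * v y)| ≤ δ * (Fintype.card W : ℝ) ^ 2

theorem exists_isQuasirandom (r : ℕ) :
    ∃ G : SimpleGraph (Fin (2 ^ (2 * r))), IsQuasirandom G (2 / 2 ^ r) := by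
  classical
  obtain ⟨χ, hsymm, hpm, horth⟩ := exists_symmetric_hadamard (2 * r)
  let G : SimpleGraph (Fin (2 ^ (2 * r))) :=
    { Adj := fun x y => x ≠ y ∧ χ x y = -1
      symm := ⟨fun x y h => ⟨h.1.symm, by rw [hsymm]; exact h.2⟩⟩
      loopless := ⟨fun x h => h.1 rfl⟩ }
  refine ⟨G, fun b u v hu hv => ?_⟩
  let σ : ℝ := if b then -1 else 1
  have hσ : |σ| = 1 := by cases b <;> simp [σ]
  -- off the diagonal the indicator is `(1 + σ χ) / 2`
  have hind : ∀ x y, adjIndicator G b x y - 1 / 2 =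
      σ / 2 * χ x y - if x = y then (1 + σ * χ x y) / 2 else 0 := by
    intro x y
    have h1 : (1 : ℝ) ≠ -1 := by norm_num
    by_cases hxy : x = y
    · simp [adjIndicator, hxy]; ring
    · rcases hpm x y with h | h <;> cases b <;> simp [adjIndicator, G, hxy, h, σ, h1] <;> norm_num
  have hcardN : (Fintype.card (Fin (2 ^ (2 * r))) : ℝ) = 2 ^ r * 2 ^ r := by
    simp [two_mul, pow_add]
  have hmain : |∑ x, ∑ y, χ x y * (u x * v y)| ≤ 2 ^ r * 2 ^ r * 2 ^ r := by
    refine abs_le_of_sq_le_sq ?_ (by positivity)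
    have := sq_sum_hadamard_le χ (fun y y' => by rw [horth]; simp) u v hu hv
    rw [hcardN] at this
    refine this.trans (le_of_eq (by ring))
  have hdiag : |∑ x, ∑ y, (if x = y then (1 + σ * χ x y) / 2 else 0) * (u x * v y)| ≤
      2 ^ r * 2 ^ r := by
    rw [← hcardN]
    have : ∀ x, ∑ y, (if x = y then (1 + σ * χ x y) / 2 else 0) * (u x * v y) =
        (1 + σ * χ x x) / 2 * (u x * v x) := by
      intro x
      simp [ite_mul]
    simp only [this]
    refine (Finset.abs_sum_le_sum_abs _ _).trans ?_
    calc _ ≤ ∑ _x : Fin (2 ^ (2 * r)), (1 : ℝ) := by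
          refine Finset.sum_le_sum fun x _ => ?_
          have h1 : |(1 + σ * χ x x) / 2| ≤ 1 := by
            rcases hpm x x with h | h <;> cases b <;> simp [h, σ]
          have h2 : |u x * v x| ≤ 1 := by
            rw [abs_of_nonneg (mul_nonneg (hu x).1 (hv x).1)]
            exact mul_le_one₀ (hu x).2 (hv x).1 (hv x).2
          rw [abs_mul]
          exact mul_le_one₀ h1 (abs_nonneg _) h2
      _ = _ := by simp
  have hsplit : ∑ x, ∑ y, (adjIndicator G b x y - 1 / 2) * (u x * v y) =
      σ / 2 * (∑ x, ∑ y, χ x y * (u x * v y)) -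
        ∑ x, ∑ y, (if x = y then (1 + σ * χ x y) / 2 else 0) * (u x * v y) := by
    simp only [hind, sub_mul, Finset.sum_sub_distrib, Finset.mul_sum, mul_assoc]
  rw [hsplit]
  have hr : (1 : ℝ) ≤ 2 ^ r := one_le_pow₀ (by norm_num)
  have hfinal : 2 / 2 ^ r * (Fintype.card (Fin (2 ^ (2 * r))) : ℝ) ^ 2 =
      2 * (2 ^ r * 2 ^ r * 2 ^ r) := by
    rw [hcardN]; field_simp
  rw [hfinal]
  refine (abs_sub _ _).trans ?_
  rw [abs_mul, abs_div, hσ, abs_two]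
  nlinarith [abs_nonneg (∑ x, ∑ y, χ x y * (u x * v y)), mul_nonneg (by linarith : (0:ℝ) ≤ 2 ^ r)
    (by linarith : (0:ℝ) ≤ 2 ^ r)]

theorem IsQuasirandom.abs_sum_sum_le {W : Type*} [Fintype W] {G : SimpleGraph W} {δ : ℝ}
    (hG : IsQuasirandom G δ) (b : Bool) (A B : Finset W) (u v : W → ℝ)
    (hu : ∀ x, u x ∈ Set.Icc (0 : ℝ) 1) (hv : ∀ x, v x ∈ Set.Icc (0 : ℝ) 1) :
    |∑ x ∈ A, ∑ y ∈ B, (adjIndicator G b x y - 1 / 2) * (u x * v y)| ≤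
      δ * (Fintype.card W : ℝ) ^ 2 := by
  classical
  have hw : ∀ (C : Finset W) (w : W → ℝ), (∀ x, w x ∈ Set.Icc (0 : ℝ) 1) →
      ∀ x, (if x ∈ C then w x else 0) ∈ Set.Icc (0 : ℝ) 1 := by
    intro C w h x
    split_ifs
    exacts [h x, by simp]
  have := hG b (fun x => if x ∈ A then u x else 0) (fun x => if x ∈ B then v x else 0)
    (hw A u hu) (hw B v hv)
  convert this using 2
  rw [← Finset.sum_filter_add_sum_filter_not Finset.univ (fun x => x ∈ A)]
  rw [Finset.sum_eq_zero (s := Finset.univ.filter (fun x => ¬ x ∈ A)), add_zero,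
    Finset.filter_mem_eq_inter, Finset.univ_inter]
  · refine Finset.sum_congr rfl fun x hx => ?_
    simp [hx, Finset.sum_ite_mem]
  · intro x hx
    simp [(Finset.mem_filter.1 hx).2]

/-- Boxes span about the expected number of triangles. -/
theorem IsQuasirandom.sum_triangles_ge {W : Type*} [Fintype W] {G : SimpleGraph W} {δ : ℝ}
    (hG : IsQuasirandom G δ) (A B C : Finset W) :
    (A.card * B.card * C.card : ℝ) / 8 - 3 * δ * (Fintype.card W : ℝ) ^ 3 ≤
      ∑ x ∈ A, ∑ y ∈ B, ∑ t ∈ C,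
        adjIndicator G true x y * adjIndicator G true y t * adjIndicator G true x t := by
  have h01 := adjIndicator_mem_Icc G true
  have hδN : 0 ≤ δ * (Fintype.card W : ℝ) ^ 2 :=
    (abs_nonneg _).trans (hG true (fun _ => 0) (fun _ => 0) (by simp) (by simp))
  have bound : ∀ (D : Finset W) (g : W → ℝ), (∀ t, |g t| ≤ δ * (Fintype.card W : ℝ) ^ 2) →
      |∑ t ∈ D, g t| ≤ δ * (Fintype.card W : ℝ) ^ 3 := by
    intro D g hg
    calc |∑ t ∈ D, g t| ≤ ∑ t ∈ D, |g t| := Finset.abs_sum_le_sum_abs _ _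
      _ ≤ ∑ _t ∈ D, δ * (Fintype.card W : ℝ) ^ 2 := Finset.sum_le_sum fun t _ => hg t
      _ = D.card * (δ * (Fintype.card W : ℝ) ^ 2) := by simp
      _ ≤ Fintype.card W * (δ * (Fintype.card W : ℝ) ^ 2) := by
          gcongr
          exact D.card_le_univ
      _ = _ := by ring
  have half01 : ∀ x : W, (1 / 2 : ℝ) ∈ Set.Icc (0 : ℝ) 1 := fun _ => by constructor <;> norm_num
  have e1 := bound C (fun t => ∑ x ∈ A, ∑ y ∈ B, (adjIndicator G true x y - 1 / 2) *
    (adjIndicator G true x t * adjIndicator G true y t)) (fun t =>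
      hG.abs_sum_sum_le true A B _ _ (fun x => h01 x t) (fun y => h01 y t))
  have e2 := bound A (fun x => ∑ y ∈ B, ∑ t ∈ C, (adjIndicator G true y t - 1 / 2) *
    (1 / 2 * adjIndicator G true x t)) (fun x =>
      hG.abs_sum_sum_le true B C _ _ half01 (fun t => h01 x t))
  have e3 := bound B (fun _ => ∑ x ∈ A, ∑ t ∈ C, (adjIndicator G true x t - 1 / 2) *
    (1 / 2 * (1 / 2))) (fun y => hG.abs_sum_sum_le true A C _ _ half01 half01)
  have hsum : ∑ x ∈ A, ∑ y ∈ B, ∑ t ∈ C,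
        adjIndicator G true x y * adjIndicator G true y t * adjIndicator G true x t =
      (A.card * B.card * C.card : ℝ) / 8 +
      (∑ t ∈ C, ∑ x ∈ A, ∑ y ∈ B, (adjIndicator G true x y - 1 / 2) *
        (adjIndicator G true x t * adjIndicator G true y t)) +
      (∑ x ∈ A, ∑ y ∈ B, ∑ t ∈ C, (adjIndicator G true y t - 1 / 2) *
        (1 / 2 * adjIndicator G true x t)) +
      (∑ y ∈ B, ∑ x ∈ A, ∑ t ∈ C, (adjIndicator G true x t - 1 / 2) *
        (1 / 2 * (1 / 2))) := by
    have hc : (A.card * B.card * C.card : ℝ) / 8 = ∑ x ∈ A, ∑ y ∈ B, ∑ t ∈ C, (1 / 8 : ℝ) := by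
      simp; ring
    have s1 : ∑ t ∈ C, ∑ x ∈ A, ∑ y ∈ B, (adjIndicator G true x y - 1 / 2) *
        (adjIndicator G true x t * adjIndicator G true y t) =
        ∑ x ∈ A, ∑ y ∈ B, ∑ t ∈ C, (adjIndicator G true x y - 1 / 2) *
        (adjIndicator G true x t * adjIndicator G true y t) := by
      rw [Finset.sum_comm]
      exact Finset.sum_congr rfl fun x _ => Finset.sum_comm
    rw [hc, s1, Finset.sum_comm (s := B) (t := A)]
    simp only [← Finset.sum_add_distrib]
    exact Finset.sum_congr rfl fun x _ => Finset.sum_congr rfl fun y _ =>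
      Finset.sum_congr rfl fun t _ => by ring
  rw [hsum]
  rw [abs_le] at e1 e2 e3
  linarith [e1.1, e2.1, e3.1]

/-! ### Sampling -/

/-- Composition with an injection `ψ` is measure preserving: a random `y : I → A` has a random
restriction `y ∘ ψ`. -/
theorem card_filter_comp_injective {V I A : Type*} [Fintype V] [Fintype I] [Fintype A]
    [DecidableEq V] [DecidableEq I] {ψ : V → I} (hψ : Function.Injective ψ)
    (Q : (V → A) → Prop) [DecidablePred Q] :
    Fintype.card (V → A) * (Finset.univ.filter (fun y : I → A => Q (y ∘ ψ))).card =
      Fintype.card (I → A) * (Finset.univ.filter Q).card := by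
  classical
  -- exchange the values of `y` along `ψ` with `z`
  have hinv : Function.Involutive
      (fun q : (I → A) × (V → A) => (Function.extend ψ q.2 q.1, q.1 ∘ ψ)) := by
    rintro ⟨y, z⟩
    refine Prod.ext ?_ ?_
    · funext i
      by_cases hi : ∃ v, ψ v = i
      · obtain ⟨v, rfl⟩ := hi
        simp [hψ.extend_apply]
      · simp [Function.extend_apply' _ _ _ hi]
    · funext v
      simp [hψ.extend_apply]
  have key (f : (V → A) → ℕ) : Fintype.card (V → A) * ∑ y : I → A, f (y ∘ ψ) =
      Fintype.card (I → A) * ∑ z, f z := by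
    have h := Equiv.sum_comp hinv.toPerm (fun q : (I → A) × (V → A) => f q.2)
    rw [Fintype.sum_prod_type, Fintype.sum_prod_type] at h
    simpa only [Function.Involutive.coe_toPerm, Finset.sum_const, Finset.card_univ, smul_eq_mul,
      ← Finset.mul_sum] using h
  simpa only [Finset.card_filter] using key (fun z => if Q z then 1 else 0)

/-- Supersaturated form of Ramsey's theorem: if every triple of `A` has one of two colours, then a
definite proportion of the maps `V → A` is homogeneous in a fixed colour. -/
theorem exists_many_homogeneous {V A : Type*} [Fintype V] [LinearOrder V] [Fintype A] [Nonempty A]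
    {M : ℕ} (hM : 2 ^ 16 ^ Fintype.card V ≤ M) (g : Bool → A → A → A → Prop)
    (hg : ∀ x y t, g true x y t ∨ g false x y t) :
    ∃ (c : Bool) (S : Finset (V → A)),
      (∀ z ∈ S, ∀ i j k, i < j → j < k → g c (z i) (z j) (z k)) ∧
      (Fintype.card A : ℝ) ^ Fintype.card V ≤ 2 * (M : ℝ) ^ Fintype.card V * S.card := by
  classical
  have hex : ∀ y : Fin M → A, ∃ q : Bool × {ψ : V → Fin M // Function.Injective ψ},
      ∀ i j k, i < j → j < k → g q.1 (y (q.2.1 i)) (y (q.2.1 j)) (y (q.2.1 k)) := by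
    intro y
    obtain ⟨ψ, c, hψ, hc⟩ := exists_strictMono_homogeneous_triples hM
      (fun a b d => decide (g true (y a) (y b) (y d)))
    refine ⟨(c, ⟨ψ, hψ.injective⟩), fun i j k hij hjk => ?_⟩
    have := hc i j k hij hjk
    cases c
    · exact (hg _ _ _).resolve_left (by simpa using this)
    · simpa using this
  choose q hq using hex
  have hne : Nonempty (Bool × {ψ : V → Fin M // Function.Injective ψ}) :=
    ⟨q (fun _ => Classical.arbitrary A)⟩
  have hcard : Fintype.card (Bool × {ψ : V → Fin M // Function.Injective ψ}) ≤
      2 * M ^ Fintype.card V := by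
    rw [Fintype.card_prod, Fintype.card_bool]
    refine Nat.mul_le_mul_left _ ((Fintype.card_subtype_le _).trans ?_)
    simp
  have hMpos : 0 < M := lt_of_lt_of_le (by positivity) hM
  have hden : (0 : ℝ) < 2 * (M : ℝ) ^ Fintype.card V := by positivity
  obtain ⟨⟨c, ψ, hψ⟩, hfib⟩ := Fintype.exists_le_card_fiber_of_nsmul_le_card q
    (b := (Fintype.card (Fin M → A) : ℝ) / (2 * (M : ℝ) ^ Fintype.card V)) (by
      rw [nsmul_eq_mul, ← mul_div_assoc, div_le_iff₀ hden, mul_comm]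
      refine mul_le_mul_of_nonneg_left ?_ (Nat.cast_nonneg _)
      exact_mod_cast hcard)
  let Q : (V → A) → Prop := fun z => ∀ i j k, i < j → j < k → g c (z i) (z j) (z k)
  refine ⟨c, Finset.univ.filter Q, fun z hz => (Finset.mem_filter.1 hz).2, ?_⟩
  have hsub : (Finset.univ.filter (fun y => q y = (c, ⟨ψ, hψ⟩))).card ≤
      (Finset.univ.filter (fun y : Fin M → A => Q (y ∘ ψ))).card := by
    refine Finset.card_le_card fun y hy => ?_
    simp only [Finset.mem_filter, Finset.mem_univ, true_and] at hy ⊢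
    have := hq y
    rw [hy] at this
    exact this
  have hcount := card_filter_comp_injective hψ Q
  have hpos : (0 : ℝ) < Fintype.card (Fin M → A) := by exact_mod_cast Fintype.card_pos
  have h1 : (Fintype.card (Fin M → A) : ℝ) ≤ 2 * (M : ℝ) ^ Fintype.card V *
      (Finset.univ.filter (fun y : Fin M → A => Q (y ∘ ψ))).card := by
    have := hfib.trans (Nat.cast_le.2 hsub)
    rw [div_le_iff₀ hden] at this
    linarith
  have h2 : (Fintype.card (V → A) : ℝ) *
      (Finset.univ.filter (fun y : Fin M → A => Q (y ∘ ψ))).card =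
      Fintype.card (Fin M → A) * (Finset.univ.filter Q).card := by exact_mod_cast hcount
  have h3 : (Fintype.card (V → A) : ℝ) = (Fintype.card A : ℝ) ^ Fintype.card V := by simp
  rw [h3] at h2
  refine le_of_mul_le_mul_left ?_ hpos
  calc (Fintype.card (Fin M → A) : ℝ) * (Fintype.card A : ℝ) ^ Fintype.card V
      ≤ 2 * (M : ℝ) ^ Fintype.card V *
        (Finset.univ.filter (fun y : Fin M → A => Q (y ∘ ψ))).card *
        (Fintype.card A : ℝ) ^ Fintype.card V := by gcongr
    _ = 2 * (M : ℝ) ^ Fintype.card V * (Fintype.card (Fin M → A) *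
        (Finset.univ.filter Q).card) := by rw [← h2]; ring
    _ = _ := by ring

/-! ### The densities of the two colour classes -/

section colour

variable {W : Type*} [DecidableEq W] (G : SimpleGraph W) (χ : triangleHypergraph G → Bool)

open Classical in
/-- The indicator function of the triples that span a triangle of `G` of colour `c`. -/
noncomputable def colourIndicator (c : Bool) (ω : W × W × W) : ℝ :=
  if ∃ h : ({ω.1, ω.2.1, ω.2.2} : Finset W) ∈ triangleHypergraph G, χ ⟨_, h⟩ = c then 1 else 0

theorem colourIndicator_mem_Icc (c : Bool) (ω : W × W × W) :
    colourIndicator G χ c ω ∈ Set.Icc (0 : ℝ) 1 := by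
  unfold colourIndicator
  split_ifs <;> simp

theorem colourIndicator_add (x y t : W) :
    colourIndicator G χ true (x, y, t) + colourIndicator G χ false (x, y, t) =
      adjIndicator G true x y * adjIndicator G true y t * adjIndicator G true x t := by
  classical
  have hadj : ∀ a b : W, adjIndicator G true a b = if G.Adj a b then 1 else 0 := by
    intro a b
    unfold adjIndicator
    by_cases h : G.Adj a b
    · simp [h, h.ne]
    · simp [h]
  have hmem : ({x, y, t} : Finset W) ∈ triangleHypergraph G ↔
      G.Adj x y ∧ G.Adj x t ∧ G.Adj y t := by
    unfold triangleHypergraph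
    rw [SimpleGraph.mem_cliqueSet_iff, SimpleGraph.is3Clique_triple_iff]
  unfold colourIndicator
  simp only [hadj]
  by_cases h : ({x, y, t} : Finset W) ∈ triangleHypergraph G
  · obtain ⟨h1, h2, h3⟩ := hmem.1 h
    cases hc : χ ⟨_, h⟩ <;> simp [h, hc, h1, h2, h3]
  · have h' := fun a b c => h (hmem.2 ⟨a, b, c⟩)
    simp only [h, IsEmpty.exists_iff, if_false, add_zero]
    by_cases h1 : G.Adj x y <;> by_cases h2 : G.Adj x t <;> by_cases h3 : G.Adj y t <;>
      simp_all

/-- In a quasirandom graph, boxes with large sides contain many triangles, so that the average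
of one of the two colour classes is bounded away from `0` there. -/
theorem exists_cellMean_colourIndicator_ge [Fintype W] {δ : ℝ} (hG : IsQuasirandom G δ)
    {K : Type*} (p : W → K) {B : ℝ} (hB : 0 ≤ B) (hδ : 3 * δ * B ^ 3 ≤ 1 / 16) (hδ0 : 0 ≤ δ)
    (x y t : W) (P : W → Finset W) (hP : ∀ a b, b ∈ P a ↔ p b = p a)
    (hx : (Fintype.card W : ℝ) ≤ B * (P x).card)
    (hy : (Fintype.card W : ℝ) ≤ B * (P y).card)
    (ht : (Fintype.card W : ℝ) ≤ B * (P t).card) :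
    1 / 32 ≤ cellMean (boxCell p) (colourIndicator G χ true) (boxCell p (x, y, t)) ∨
    1 / 32 ≤ cellMean (boxCell p) (colourIndicator G χ false) (boxCell p (x, y, t)) := by
  classical
  have hcell : Finset.univ.filter (fun ω => boxCell p ω = boxCell p (x, y, t)) =
      P x ×ˢ P y ×ˢ P t := by
    ext ω
    simp [boxCell, hP, Prod.ext_iff]
  have hpos : ∀ a, (0 : ℝ) < (P a).card := fun a => by
    exact_mod_cast Finset.card_pos.2 ⟨a, (hP a a).2 rfl⟩
  have hcard : ((P x ×ˢ P y ×ˢ P t).card : ℝ) = (P x).card * (P y).card * (P t).card := by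
    simp [Finset.card_product]; ring
  have hcpos : (0 : ℝ) < (P x).card * (P y).card * (P t).card :=
    mul_pos (mul_pos (hpos x) (hpos y)) (hpos t)
  have hadd : cellMean (boxCell p) (colourIndicator G χ true) (boxCell p (x, y, t)) +
      cellMean (boxCell p) (colourIndicator G χ false) (boxCell p (x, y, t)) =
      (∑ a ∈ P x, ∑ b ∈ P y, ∑ d ∈ P t,
        adjIndicator G true a b * adjIndicator G true b d * adjIndicator G true a d) /
        ((P x).card * (P y).card * (P t).card) := by
    unfold cellMean
    have hcell' : ∀ inst : DecidablePred (fun ω => boxCell p ω = boxCell p (x, y, t)),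
        @Finset.filter _ (fun ω => boxCell p ω = boxCell p (x, y, t)) inst Finset.univ =
        P x ×ˢ P y ×ˢ P t := by
      intro inst
      rw [← hcell]
      congr
    simp only [hcell', ← add_div, ← Finset.sum_add_distrib, hcard]
    congr 1
    rw [Finset.sum_product]
    refine Finset.sum_congr rfl fun a _ => ?_
    rw [Finset.sum_product]
    exact Finset.sum_congr rfl fun b _ => Finset.sum_congr rfl fun d _ =>
      colourIndicator_add G χ a b d
  have hN : (Fintype.card W : ℝ) ^ 3 ≤ B ^ 3 * ((P x).card * (P y).card * (P t).card) := by
    have h0 : (0 : ℝ) ≤ Fintype.card W := Nat.cast_nonneg _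
    calc (Fintype.card W : ℝ) ^ 3 = Fintype.card W * Fintype.card W * Fintype.card W := by ring
      _ ≤ (B * (P x).card) * (B * (P y).card) * (B * (P t).card) := by gcongr
      _ = _ := by ring
  have htri := hG.sum_triangles_ge (P x) (P y) (P t)
  have h1 : 3 * δ * (Fintype.card W : ℝ) ^ 3 ≤
      1 / 16 * ((P x).card * (P y).card * (P t).card) := by
    calc 3 * δ * (Fintype.card W : ℝ) ^ 3
        ≤ 3 * δ * (B ^ 3 * ((P x).card * (P y).card * (P t).card)) := by gcongr
      _ = (3 * δ * B ^ 3) * ((P x).card * (P y).card * (P t).card) := by ring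
      _ ≤ _ := by gcongr
  have h2 : 1 / 16 ≤ (∑ a ∈ P x, ∑ b ∈ P y, ∑ d ∈ P t,
        adjIndicator G true a b * adjIndicator G true b d * adjIndicator G true a d) /
        ((P x).card * (P y).card * (P t).card) := by
    rw [le_div_iff₀ hcpos]
    linarith
  rw [← hadd] at h2
  by_contra! hcon
  linarith [hcon.1, hcon.2]

end colour

/-- At least half of the points lie in cells of at least half the average size. -/
theorem card_le_two_mul_card_large_cells {W K : Type*} [Fintype W] [Fintype K] [DecidableEq K]
    [Nonempty W] (p : W → K) :
    Fintype.card W ≤ 2 * (Finset.univ.filter (fun x => Fintype.card W ≤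
      2 * Fintype.card K * (Finset.univ.filter (fun y => p y = p x)).card)).card := by
  set N := Fintype.card W with hN
  set big : K → Prop := fun l => N ≤ 2 * Fintype.card K *
    (Finset.univ.filter (fun y => p y = l)).card with hbig
  have hsplit := Finset.card_filter_add_card_filter_not (s := (Finset.univ : Finset W))
    (fun x => big (p x))
  rw [Finset.card_univ, ← hN] at hsplit
  have hK : 0 < Fintype.card K := Fintype.card_pos_iff.2 ⟨p (Classical.arbitrary W)⟩
  have hsmall : 2 * Fintype.card K * (Finset.univ.filter (fun x => ¬ big (p x))).card ≤
      Fintype.card K * N := by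
    rw [Finset.card_eq_sum_card_fiberwise (f := p) (t := Finset.univ) (by intro _ _; simp),
      Finset.mul_sum]
    calc _ ≤ ∑ _l : K, N := by
          refine Finset.sum_le_sum fun l _ => ?_
          by_cases hl : big l
          · rw [Finset.card_eq_zero.2]
            · simp
            · ext x
              simp only [Finset.mem_filter, Finset.mem_univ, true_and, Finset.notMem_empty,
                iff_false, not_and]
              rintro h rfl
              exact h hl
          · refine le_trans ?_ (not_le.1 hl).le
            refine Nat.mul_le_mul_left _ (Finset.card_le_card fun x hx => ?_)
            simp only [Finset.mem_filter, Finset.mem_univ, true_and] at hx ⊢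
            exact hx.2
      _ = _ := by simp
  have h2 : 2 * (Finset.univ.filter (fun x => ¬ big (p x))).card ≤ N := by
    refine Nat.le_of_mul_le_mul_left ?_ hK
    linarith
  show N ≤ 2 * (Finset.univ.filter (fun x => big (p x))).card
  omega

/-! ### Finding a monochromatic induced copy -/

/-- A map `z` at which no controlling factor vanishes is an induced embedding, and the triangles of
its image have colour `c`. -/
theorem exists_embedding_of_colourIndicator_ne_zero {V W : Type*} [DecidableEq V] [DecidableEq W]
    (F : SimpleGraph V) (G : SimpleGraph W) (χ : triangleHypergraph G → Bool) (c : Bool)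
    (z : V → W)
    (hT : ∀ T, F.IsNClique 3 T →
      ∃ i j k, T = {i, j, k} ∧ colourIndicator G χ c (z i, z j, z k) ≠ 0)
    (hP : ∀ i j, i ≠ j → (∀ T, F.IsNClique 3 T → ¬ ({i, j} : Finset V) ⊆ T) →
      z i ≠ z j ∧ (F.Adj i j ↔ G.Adj (z i) (z j))) :
    ∃ φ : F ↪g G, ∀ t : triangleHypergraph G,
      ((t : Finset W) : Set W) ⊆ Set.range φ → χ t = c := by
  have hT' : ∀ T, F.IsNClique 3 T → ∃ h : T.image z ∈ triangleHypergraph G, χ ⟨_, h⟩ = c := by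
    intro T hTc
    obtain ⟨i, j, k, rfl, hne⟩ := hT T hTc
    have hex : ∃ h : ({z i, z j, z k} : Finset W) ∈ triangleHypergraph G, χ ⟨_, h⟩ = c := by
      by_contra hcon
      exact hne (if_neg hcon)
    have himg : ({i, j, k} : Finset V).image z = {z i, z j, z k} := by
      simp [Finset.image_insert]
    rw [himg]
    exact hex
  have hpair : ∀ i j, i ≠ j → z i ≠ z j ∧ (F.Adj i j ↔ G.Adj (z i) (z j)) := by
    intro i j hij
    by_cases hcov : ∀ T, F.IsNClique 3 T → ¬ ({i, j} : Finset V) ⊆ T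
    · exact hP i j hij hcov
    · push Not at hcov
      obtain ⟨T, hTc, hsub⟩ := hcov
      have hi : i ∈ T := hsub (by simp)
      have hj : j ∈ T := hsub (by simp)
      obtain ⟨h, -⟩ := hT' T hTc
      have hG3 : G.IsNClique 3 (T.image z) := h
      -- an image of a triangle that has three vertices is injective on the triangle
      have hinj : Set.InjOn z T :=
        Finset.card_image_iff.1 (by rw [hG3.card_eq, hTc.card_eq])
      have hne : z i ≠ z j := fun h => hij (hinj hi hj h)
      refine ⟨hne, iff_of_true (hTc.isClique hi hj hij) ?_⟩
      exact hG3.isClique (by simpa using ⟨i, hi, rfl⟩) (by simpa using ⟨j, hj, rfl⟩) hne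
  have hzinj : Function.Injective z := fun i j h => by
    by_contra hij
    exact (hpair i j hij).1 h
  have hmap : ∀ i j, G.Adj (z i) (z j) ↔ F.Adj i j := by
    intro i j
    by_cases hij : i = j
    · subst hij; simp
    · exact (hpair i j hij).2.symm
  refine ⟨⟨⟨z, hzinj⟩, fun {i j} => hmap i j⟩, ?_⟩
  rintro ⟨t, ht⟩ hrange
  have ht3 : G.IsNClique 3 t := ht
  obtain ⟨x, y, w, hxy, hxw, hyw, rfl⟩ := SimpleGraph.is3Clique_iff.1 ht3
  obtain ⟨i, rfl⟩ := hrange (show x ∈ (({x, y, w} : Finset W) : Set W) by simp)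
  obtain ⟨j, rfl⟩ := hrange (show y ∈ (({_, y, w} : Finset W) : Set W) by simp)
  obtain ⟨k, rfl⟩ := hrange (show w ∈ (({_, _, w} : Finset W) : Set W) by simp)
  obtain ⟨h, hc⟩ := hT' {i, j, k}
    (SimpleGraph.is3Clique_triple_iff.2 ⟨(hmap i j).1 hxy, (hmap i k).1 hxw, (hmap j k).1 hyw⟩)
  rw [← hc]
  congr 2
  simp [Finset.image_insert]

open Classical in
/-- The hyperedges that control an induced copy of `F`: the triangles of `F`, and the pairs of
vertices that lie in no triangle. -/
noncomputable def controlSystem {V : Type*} [Fintype V] (F : SimpleGraph V) : Finset (Finset V) :=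
  Finset.univ.filter fun e =>
    F.IsNClique 3 e ∨ (e.card = 2 ∧ ∀ T, F.IsNClique 3 T → ¬ e ⊆ T)

theorem mem_controlSystem {V : Type*} [Fintype V] {F : SimpleGraph V} {e : Finset V} :
    e ∈ controlSystem F ↔
      F.IsNClique 3 e ∨ (e.card = 2 ∧ ∀ T, F.IsNClique 3 T → ¬ e ⊆ T) := by
  simp [controlSystem]

theorem controlSystem_inter_subsingleton {V : Type*} [Fintype V] [DecidableEq V]
    {F : SimpleGraph V} (hF : IsLinearHypergraph (triangleHypergraph F)) :
    ∀ e ∈ controlSystem F, ∀ e' ∈ controlSystem F, e ≠ e' →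
      ((e : Set V) ∩ e').Subsingleton := by
  -- two common vertices of a pair `e` and a hyperedge `e'` exhaust `e`
  have hpair : ∀ e e' : Finset V, e.card = 2 → ¬ e ⊆ e' → ((e : Set V) ∩ e').Subsingleton := by
    intro e e' he hsub x hx y hy
    by_contra hxy
    obtain ⟨a, b, -, rfl⟩ := Finset.card_eq_two.1 he
    apply hsub
    simp only [Set.mem_inter_iff, Finset.mem_coe, Finset.mem_insert, Finset.mem_singleton] at hx hy
    intro w hw
    simp only [Finset.mem_insert, Finset.mem_singleton] at hw
    grind
  intro e he e' he' hne
  rcases mem_controlSystem.1 he with h | ⟨h2, hcov⟩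
  · rcases mem_controlSystem.1 he' with h' | ⟨h2', hcov'⟩
    · exact hF h h' hne
    · rw [Set.inter_comm]
      exact hpair e' e h2' (hcov' e h)
  · rcases mem_controlSystem.1 he' with h' | ⟨h2', -⟩
    · exact hpair e e' h2 (hcov e' h')
    · exact hpair e e' h2 fun hsub => hne (Finset.eq_of_subset_of_card_le hsub (by omega))

theorem exists_lt_lt_of_card_eq_three {V : Type*} [LinearOrder V] {e : Finset V}
    (h : e.card = 3) : ∃ a b d, a < b ∧ b < d ∧ e = {a, b, d} := by
  have himg : ∀ f : Fin 3 → V, Finset.univ.image f = {f 0, f 1, f 2} := by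
    intro f; ext x; simp [Fin.exists_fin_succ, eq_comm]
  have hmono := (e.orderEmbOfFin h).strictMono
  exact ⟨_, _, _, hmono (by decide : (0 : Fin 3) < 1), hmono (by decide : (1 : Fin 3) < 2),
    (Finset.image_orderEmbOfFin_univ e h).symm.trans (himg _)⟩

theorem exists_lt_of_card_eq_two {V : Type*} [LinearOrder V] {e : Finset V}
    (h : e.card = 2) : ∃ a b, a < b ∧ e = {a, b} := by
  have himg : ∀ f : Fin 2 → V, Finset.univ.image f = {f 0, f 1} := by
    intro f; ext x; simp [Fin.exists_fin_succ, eq_comm]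
  have hmono := (e.orderEmbOfFin h).strictMono
  exact ⟨_, _, hmono (by decide : (0 : Fin 2) < 1),
    (Finset.image_orderEmbOfFin_univ e h).symm.trans (himg _)⟩

/-- A sufficiently quasirandom graph on sufficiently many vertices has a
monochromatic induced copy of `F`. Here `M` is the Ramsey number that governs the supersaturation,
`ε` the precision in cut norm, and `8 ^ k` the number of cells. -/
theorem exists_monochromatic_embedding {V W : Type*} [Fintype V] [LinearOrder V] [Nonempty V]
    [Fintype W] [DecidableEq W] [Nonempty W] {F : SimpleGraph V}
    (hF : IsLinearHypergraph (triangleHypergraph F)) {G : SimpleGraph W}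
    (χ : triangleHypergraph G → Bool) {δ ε : ℝ} {M k : ℕ} (hG : IsQuasirandom G δ)
    (hM : 2 ^ 16 ^ Fintype.card V ≤ M) (hδ0 : 0 ≤ δ) (hε : 0 < ε) (hk : 2 < k * ε ^ 2)
    (hδk : 3 * δ * (2 * 8 ^ k) ^ 3 ≤ 1 / 16) (hδε : δ ≤ ε)
    (hεM : 2 ^ Fintype.card V * ε <
      (1 / 2) ^ Fintype.card V / (2 * (M : ℝ) ^ Fintype.card V) * (1 / 32) ^ 2 ^ Fintype.card V) :
    ∃ (φ : F ↪g G) (c : Bool), ∀ t : triangleHypergraph G,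
      ((t : Finset W) : Set W) ⊆ Set.range φ → χ t = c := by
  classical
  set n := Fintype.card V with hn
  set N : ℝ := ((Fintype.card W : ℕ) : ℝ) with hN
  have hNpos : 0 < N := by rw [hN]; exact_mod_cast Fintype.card_pos
  have hMpos : (0 : ℝ) < M := by exact_mod_cast lt_of_lt_of_le (by positivity) hM
  have hf01 := colourIndicator_mem_Icc G χ
  obtain ⟨K, iF, p, hK, hreg⟩ := exists_weakRegular_partition (colourIndicator G χ) hf01 ε hε k hk
  -- points in large cells
  let A := {x : W // Fintype.card W ≤
      2 * Fintype.card K * (Finset.univ.filter (fun y => p y = p x)).card}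
  have hAcard : N ≤ 2 * (Fintype.card A : ℝ) := by
    have h := card_le_two_mul_card_large_cells p
    rw [← Fintype.card_subtype] at h
    have h' : Fintype.card W ≤ 2 * Fintype.card A := h
    rw [hN]
    exact_mod_cast h'
  have hAne : Nonempty A := by
    rw [← Fintype.card_pos_iff]
    have : (0 : ℝ) < Fintype.card A := by linarith
    exact_mod_cast this
  have hKR : (Fintype.card K : ℝ) ≤ 8 ^ k := by exact_mod_cast hK
  have hAbig : ∀ x : A, (Fintype.card W : ℝ) ≤
      (2 * 8 ^ k : ℝ) * (Finset.univ.filter (fun y => p y = p x.1)).card := by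
    intro x
    calc (Fintype.card W : ℝ)
        ≤ 2 * Fintype.card K * (Finset.univ.filter (fun y => p y = p x.1)).card := by
          exact_mod_cast x.2
      _ ≤ _ := by gcongr
  let gm : Bool → W → W → W → ℝ := fun c x y t =>
    cellMean (boxCell p) (colourIndicator G χ c) (boxCell p (x, y, t))
  have hgm01 : ∀ c x y t, gm c x y t ∈ Set.Icc (0 : ℝ) 1 := fun c x y t =>
    cellMean_mem_Icc _ _ (hf01 c) _
  -- `S`: the tuples on which the averages of colour `c` are at least `1 / 32`
  obtain ⟨c, S, hS, hScard⟩ := exists_many_homogeneous (V := V) (A := A) hM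
    (fun c x y t => 1 / 32 ≤ gm c x.1 y.1 t.1)
    (fun x y t => exists_cellMean_colourIndicator_ge G χ hG p (by positivity) hδk hδ0
      x.1 y.1 t.1 (fun a => Finset.univ.filter (fun y => p y = p a)) (by simp)
      (hAbig x) (hAbig y) (hAbig t))
  -- an increasing enumeration of each hyperedge
  have henum : ∀ e : Finset V, ∃ a b d : V, (e.card = 3 → a < b ∧ b < d ∧ e = {a, b, d}) ∧
      (e.card = 2 → a < b ∧ e = {a, b}) := by
    intro e
    by_cases h3 : e.card = 3
    · obtain ⟨a, b, d, hab, hbd, he⟩ := exists_lt_lt_of_card_eq_three h3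
      exact ⟨a, b, d, fun _ => ⟨hab, hbd, he⟩, fun h => by omega⟩
    · by_cases h2 : e.card = 2
      · obtain ⟨a, b, hab, he⟩ := exists_lt_of_card_eq_two h2
        exact ⟨a, b, b, fun h => by omega, fun _ => ⟨hab, he⟩⟩
      · exact ⟨Classical.arbitrary V, Classical.arbitrary V, Classical.arbitrary V,
          fun h => absurd h h3, fun h => absurd h h2⟩
  choose i j l hijl using henum
  -- `∏ u` counts the induced copies of `F` in colour `c`, and `v` is the dense model of `u`
  let u : Finset V → (V → W) → ℝ := fun e z =>
    if e.card = 3 then colourIndicator G χ c (z (i e), z (j e), z (l e))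
    else adjIndicator G (decide (F.Adj (i e) (j e))) (z (i e)) (z (j e))
  let v : Finset V → (V → W) → ℝ := fun e z =>
    if e.card = 3 then gm c (z (i e)) (z (j e)) (z (l e)) else 1 / 2
  have hu01 : ∀ e z, u e z ∈ Set.Icc (0 : ℝ) 1 := by
    intro e z
    simp only [u]
    split_ifs
    exacts [hf01 _ _, adjIndicator_mem_Icc _ _ _ _]
  have hv01 : ∀ e z, v e z ∈ Set.Icc (0 : ℝ) 1 := by
    intro e z
    simp only [v]
    split_ifs
    · exact hgm01 _ _ _ _
    · constructor <;> norm_num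
  have hcard : ∀ e ∈ controlSystem F, e.card = 3 ∨ e.card = 2 := by
    intro e he
    rcases mem_controlSystem.1 he with h | h
    exacts [Or.inl h.card_eq, Or.inr h.1]
  have hdep : ∀ e ∈ controlSystem F, ∀ z z' : V → W, (∀ x ∈ (e : Set V), z x = z' x) →
      z (i e) = z' (i e) ∧ z (j e) = z' (j e) ∧ (e.card = 3 → z (l e) = z' (l e)) := by
    intro e he z z' hz
    rcases hcard e he with h3 | h2
    · obtain ⟨-, -, heq⟩ := (hijl e).1 h3
      exact ⟨hz _ ((Finset.ext_iff.1 heq _).2 (by simp)),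
        hz _ ((Finset.ext_iff.1 heq _).2 (by simp)),
        fun _ => hz _ ((Finset.ext_iff.1 heq _).2 (by simp))⟩
    · obtain ⟨-, heq⟩ := (hijl e).2 h2
      exact ⟨hz _ ((Finset.ext_iff.1 heq _).2 (by simp)),
        hz _ ((Finset.ext_iff.1 heq _).2 (by simp)),
        fun h => by omega⟩
  have hud : ∀ e ∈ controlSystem F, DependsOn (u e) (e : Set V) := by
    intro e he z z' hz
    obtain ⟨h1, h2, h3⟩ := hdep e he z z' hz
    simp only [u, h1, h2]
    split_ifs with h
    · rw [h3 h]
    · rfl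
  have hvd : ∀ e ∈ controlSystem F, DependsOn (v e) (e : Set V) := by
    intro e he z z' hz
    obtain ⟨h1, h2, h3⟩ := hdep e he z z' hz
    simp only [v, h1, h2]
    split_ifs with h
    · rw [h3 h]
    · rfl
  have hbox : ∀ e ∈ controlSystem F, BoxSmall e (fun z => u e z - v e z) ε := by
    intro e he
    rcases hcard e he with h3 | h2
    · obtain ⟨hab, hbd, heq⟩ := (hijl e).1 h3
      have hb := boxSmall_triple (W := W) hab.ne (hab.trans hbd).ne hbd.ne
        (fun x y t => colourIndicator G χ c (x, y, t) - gm c x y t) ε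
        (abs_sum_box_weights_le _ _ fun A₁ A₂ A₃ => by
          simpa only [Finset.sum_product] using hreg c A₁ A₂ A₃)
      rw [← heq] at hb
      simpa only [u, v, h3, if_true] using hb
    · obtain ⟨hab, heq⟩ := (hijl e).2 h2
      have hb := boxSmall_pair (W := W) hab.ne
        (fun x y => adjIndicator G (decide (F.Adj (i e) (j e))) x y - 1 / 2) ε
        (fun a b ha hb => (hG _ a b ha hb).trans (by gcongr))
      rw [← heq] at hb
      have h3 : ¬ e.card = 3 := by omega
      simpa only [u, v, h3, if_false] using hb
  have hne : ∀ e ∈ controlSystem F, e.Nonempty := by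
    intro e he
    rw [← Finset.card_pos]
    rcases hcard e he with h | h <;> omega
  have hcount := abs_sum_prod_sub_sum_prod_le (controlSystem F) hne
    (controlSystem_inter_subsingleton hF) u v hu01 hv01 hud hvd ε hbox
  have hE : (controlSystem F).card ≤ 2 ^ n := by
    have := (controlSystem F).card_le_univ
    rwa [Fintype.card_finset] at this
  -- the main term
  have hmain : (S.card : ℝ) * (1 / 32) ^ 2 ^ n ≤ ∑ z, ∏ e ∈ controlSystem F, v e z := by
    have hinj : Function.Injective (fun (z : V → A) (x : V) => (z x).1) := fun z z' h =>
      funext fun x => Subtype.ext (congrFun h x)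
    calc (S.card : ℝ) * (1 / 32) ^ 2 ^ n
        = ∑ _z ∈ S.image (fun (z : V → A) (x : V) => (z x).1), (1 / 32 : ℝ) ^ 2 ^ n := by
          rw [Finset.sum_const, Finset.card_image_of_injective _ hinj, nsmul_eq_mul]
      _ ≤ ∑ z ∈ S.image (fun (z : V → A) (x : V) => (z x).1),
            ∏ e ∈ controlSystem F, v e z := by
          refine Finset.sum_le_sum fun z hz => ?_
          obtain ⟨z', hz', rfl⟩ := Finset.mem_image.1 hz
          calc (1 / 32 : ℝ) ^ 2 ^ n ≤ (1 / 32) ^ (controlSystem F).card :=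
                pow_le_pow_of_le_one (by norm_num) (by norm_num) hE
            _ = ∏ _e ∈ controlSystem F, (1 / 32 : ℝ) := by simp
            _ ≤ _ := by
                refine Finset.prod_le_prod (fun _ _ => by norm_num) fun e he => ?_
                simp only [v]
                split_ifs with h3
                · obtain ⟨hab, hbd, -⟩ := (hijl e).1 h3
                  exact hS z' hz' _ _ _ hab hbd
                · norm_num
      _ ≤ _ := Finset.sum_le_sum_of_subset_of_nonneg (Finset.subset_univ _) fun z _ _ =>
          Finset.prod_nonneg fun e _ => (hv01 e z).1
  have hSlarge : (1 / 2) ^ n / (2 * (M : ℝ) ^ n) * N ^ n ≤ S.card := by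
    have hden : (0 : ℝ) < 2 * (M : ℝ) ^ n := by positivity
    rw [div_mul_eq_mul_div, div_le_iff₀ hden, ← mul_pow]
    calc (1 / 2 * N) ^ n ≤ (Fintype.card A : ℝ) ^ n := by
          gcongr
          linarith
      _ ≤ _ := by linarith [hScard]
  have hNn : 0 < N ^ n := by positivity
  have herr : ((controlSystem F).card : ℝ) * (ε * N ^ n) ≤ 2 ^ n * ε * N ^ n := by
    have h1 : ((controlSystem F).card : ℝ) ≤ 2 ^ n := by exact_mod_cast hE
    rw [← mul_assoc]
    gcongr
  have hpos : 0 < ∑ z, ∏ e ∈ controlSystem F, u e z := by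
    have h1 : 2 ^ n * ε * N ^ n < (S.card : ℝ) * (1 / 32) ^ 2 ^ n := by
      calc 2 ^ n * ε * N ^ n
          < (1 / 2) ^ n / (2 * (M : ℝ) ^ n) * (1 / 32) ^ 2 ^ n * N ^ n := by gcongr
        _ = (1 / 2) ^ n / (2 * (M : ℝ) ^ n) * N ^ n * (1 / 32) ^ 2 ^ n := by ring
        _ ≤ _ := by gcongr
    have h2 := (abs_le.1 hcount).1
    linarith
  obtain ⟨z, -, hz⟩ := Finset.exists_ne_zero_of_sum_ne_zero hpos.ne'
  have hz' : ∀ e ∈ controlSystem F, u e z ≠ 0 := Finset.prod_ne_zero_iff.1 hz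
  obtain ⟨φ, hφ⟩ := exists_embedding_of_colourIndicator_ne_zero F G χ c z
    (by
      intro T hT
      obtain ⟨-, -, heq⟩ := (hijl T).1 hT.card_eq
      refine ⟨i T, j T, l T, heq, ?_⟩
      have := hz' T (mem_controlSystem.2 (Or.inl hT))
      simpa only [u, hT.card_eq, if_true] using this)
    (by
      intro x y hxy hcov
      have h2 : ({x, y} : Finset V).card = 2 := Finset.card_pair hxy
      have h3 : ¬ ({x, y} : Finset V).card = 3 := by omega
      have h := hz' {x, y} (mem_controlSystem.2 (Or.inr ⟨h2, hcov⟩))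
      obtain ⟨-, heq⟩ := (hijl {x, y}).2 h2
      simp only [u, h3, if_false] at h
      have hadj : ∀ a b : V, adjIndicator G (decide (F.Adj a b)) (z a) (z b) ≠ 0 →
          z a ≠ z b ∧ (F.Adj a b ↔ G.Adj (z a) (z b)) := by
        intro a b hab
        by_contra hcon
        refine hab (if_neg fun hc => hcon ⟨hc.1, ?_⟩)
        simpa using hc.2.symm
      have h' := hadj _ _ h
      generalize i {x, y} = a at heq h'
      generalize j {x, y} = b at heq h'
      have hx : x = a ∨ x = b := by
        have : x ∈ ({a, b} : Finset V) := heq ▸ (by simp)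
        simpa using this
      have hy : y = a ∨ y = b := by
        have : y ∈ ({a, b} : Finset V) := heq ▸ (by simp)
        simpa using this
      rcases hx with rfl | rfl <;> rcases hy with rfl | rfl
      · exact absurd rfl hxy
      · exact h'
      · exact ⟨h'.1.symm, by rw [F.adj_comm, G.adj_comm]; exact h'.2⟩
      · exact absurd rfl hxy)
  exact ⟨φ, c, hφ⟩

/-! ### Choice of the parameters -/

theorem triangleArrow_of_isEmpty {V W : Type*} [IsEmpty V] (G : SimpleGraph W)
    (F : SimpleGraph V) : TriangleArrow G F := by
  intro χ
  refine ⟨⟨⟨isEmptyElim, fun a => isEmptyElim a⟩, fun {a} => isEmptyElim a⟩, true, ?_⟩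
  rintro ⟨t, ht⟩ hsub
  have ht3 : G.IsNClique 3 t := ht
  obtain ⟨x, hx⟩ : t.Nonempty := Finset.card_pos.1 (by rw [ht3.card_eq]; norm_num)
  obtain ⟨v, -⟩ := hsub hx
  exact isEmptyElim v

theorem exists_triangleArrow {V : Type*} [Fintype V] [Nonempty V] (F : SimpleGraph V)
    (hF : IsLinearHypergraph (triangleHypergraph F)) :
    ∃ G : SimpleGraph (Fin (2 ^ 2 ^ 2 ^ (40 * Fintype.card V))), TriangleArrow G F := by
  let _ : LinearOrder V :=
    LinearOrder.lift' (Fintype.equivFin V) (Fintype.equivFin V).injective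
  set n := Fintype.card V with hn
  have hn1 : 1 ≤ n := Fintype.card_pos
  -- precision `ε = 2 ^ (-L)`, at most `8 ^ k` cells, and `2 ^ (2 * r)` vertices
  obtain ⟨L, hL⟩ : ∃ L : ℕ, L = 2 ^ (10 * n) := ⟨_, rfl⟩
  obtain ⟨k, hk⟩ : ∃ k : ℕ, k = 2 ^ (2 * L + 2) := ⟨_, rfl⟩
  obtain ⟨r, hr⟩ : ∃ r : ℕ, r = 2 ^ (2 ^ (40 * n) - 1) := ⟨_, rfl⟩
  have hrr : 2 * r = 2 ^ 2 ^ (40 * n) := by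
    rw [hr, mul_comm, ← pow_succ, Nat.sub_add_cancel Nat.one_le_two_pow]
  have hLbig : 1024 ≤ L := by
    rw [hL]
    calc 1024 = 2 ^ (10 * 1) := by norm_num
      _ ≤ _ := Nat.pow_le_pow_right (by norm_num) (by omega)
  have hL4 : 2 ^ (40 * n) = L ^ 4 := by
    rw [hL, ← pow_mul]
    congr 1
    ring
  have hkL : L < k := by
    rw [hk]
    calc L < 2 ^ L := Nat.lt_two_pow_self
      _ ≤ _ := Nat.pow_le_pow_right (by norm_num) (by omega)
  have hrk : 10 + 9 * k ≤ r := by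
    have h1 : 2 * L + 7 ≤ 2 ^ (40 * n) := by
      rw [hL4]
      nlinarith [Nat.pow_le_pow_left hLbig 2, sq_nonneg L]
    calc 10 + 9 * k ≤ 2 ^ 4 * k := by omega
      _ = 2 ^ (2 * L + 6) := by rw [hk, ← pow_add]; congr 1; ring
      _ ≤ r := by
        rw [hr]
        exact Nat.pow_le_pow_right (by norm_num) (by omega)
  -- the exponents of `1 / 2` in the main term of the count add up to less than `L`
  have hexp : 2 * n + 1 + 16 ^ n * n + 5 * 2 ^ n < L := by
    have hq : n < 2 ^ n := Nat.lt_two_pow_self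
    have hq2 : 2 ≤ 2 ^ n := by omega
    have h16 : 16 ^ n = (2 ^ n) ^ 4 := by
      rw [← pow_mul, mul_comm n 4, pow_mul]; norm_num
    have hL' : L = (2 ^ n) ^ 10 := by rw [hL, ← pow_mul, mul_comm]
    rw [h16, hL']
    generalize 2 ^ n = q at hq hq2
    calc 2 * n + 1 + q ^ 4 * n + 5 * q ≤ 2 * q + q + q ^ 4 * q + 5 * q := by
          gcongr
          omega
      _ = q ^ 5 + 8 * q := by ring
      _ ≤ q ^ 5 + q ^ 3 * q := by
          gcongr
          calc 8 = 2 ^ 3 := by norm_num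
            _ ≤ q ^ 3 := Nat.pow_le_pow_left hq2 3
      _ = q ^ 5 + q ^ 4 := by ring
      _ ≤ q ^ 5 + q ^ 5 := by
          gcongr <;> omega
      _ ≤ q * q ^ 5 := by nlinarith [Nat.zero_le (q ^ 5)]
      _ = q ^ 6 := by ring
      _ < q ^ 10 := Nat.pow_lt_pow_right (by omega) (by norm_num)
  obtain ⟨G, hG⟩ := exists_isQuasirandom r
  rw [← hrr]
  refine ⟨G, fun χ => ?_⟩
  refine exists_monochromatic_embedding hF χ (ε := (1 / 2) ^ L) (M := 2 ^ 16 ^ n) (k := k) hG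
    le_rfl (by positivity) (by positivity) ?_ ?_ ?_ ?_
  · rw [hk]
    push_cast
    rw [← pow_mul, mul_comm L 2, pow_add, one_div, inv_pow]
    field_simp
    norm_num
  · have h2 : (768 : ℝ) * 2 ^ (9 * k) ≤ 2 ^ r := by
      calc (768 : ℝ) * 2 ^ (9 * k) ≤ 2 ^ 10 * 2 ^ (9 * k) := by gcongr; norm_num
        _ = 2 ^ (10 + 9 * k) := by rw [pow_add]
        _ ≤ 2 ^ r := pow_le_pow_right₀ (by norm_num) hrk
    have h8 : ((2 : ℝ) * 8 ^ k) ^ 3 = 8 * 2 ^ (9 * k) := by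
      rw [mul_pow, ← pow_mul, pow_mul 2 9 k, mul_comm k 3, pow_mul 8 3 k]
      norm_num
    have hpos : (0 : ℝ) < 2 ^ r := by positivity
    rw [h8]
    have : 3 * (2 / (2 : ℝ) ^ r) * (8 * 2 ^ (9 * k)) = (48 * 2 ^ (9 * k)) / 2 ^ r := by ring
    rw [this, div_le_div_iff₀ hpos (by norm_num)]
    linarith
  · have hpos : (0 : ℝ) < 2 ^ r := by positivity
    rw [div_le_iff₀ hpos, one_div, inv_pow, inv_mul_eq_div, le_div_iff₀ (by positivity), mul_comm,
      ← pow_succ]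
    exact pow_le_pow_right₀ (by norm_num) (by omega)
  · have h1 : ((1 : ℝ) / 2) ^ n / (2 * ((2 ^ 16 ^ n : ℕ) : ℝ) ^ n) * (1 / 32) ^ 2 ^ n =
        (1 / 2) ^ (n + (1 + 16 ^ n * n) + 5 * 2 ^ n) := by
      have h32 : (1 / 32 : ℝ) = (1 / 2) ^ 5 := by norm_num
      rw [pow_add, pow_add, pow_mul _ 5, ← h32]
      push_cast
      rw [← pow_mul, pow_add _ 1, div_eq_mul_inv]
      simp [one_div, mul_comm]
    have h2 : (2 : ℝ) ^ n * (1 / 2) ^ L = (1 / 2) ^ (L - n) := by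
      have : L = (L - n) + n := by omega
      conv_lhs => rw [this, pow_add]
      rw [mul_left_comm, ← mul_pow]
      norm_num
    rw [← hn, h1, h2]
    exact pow_lt_pow_right_of_lt_one₀ (by norm_num) (by norm_num) (by omega)

theorem theorem1 {V : Type*} [Fintype V] (F : SimpleGraph V) (n : ℕ)
    (hn : Fintype.card V = n) (hF : IsLinearHypergraph (triangleHypergraph F)) :
    (∃ G : SimpleGraph (Fin (2 ^ 2 ^ 2 ^ (40 * n))), TriangleArrow G F) ∧
      inducedTriangleRamsey F ≤ 2 ^ 2 ^ 2 ^ (40 * n) := by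
  have h : ∃ G : SimpleGraph (Fin (2 ^ 2 ^ 2 ^ (40 * n))), TriangleArrow G F := by
    subst hn
    rcases isEmpty_or_nonempty V with hV | hV
    · exact ⟨⊥, triangleArrow_of_isEmpty _ _⟩
    · exact exists_triangleArrow F hF
  exact ⟨h, Nat.sInf_le h⟩
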